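/- **Setting.** There are $n\ge 2$ bidders in a first-price sealed-bid auction with uniform tie-breaking; bids are nonnegative reals. A bidder with value $v$ who bids $b$ gets $(v-b)/k$ if $b$ is the highest bid and exactly $k$ bidders bid $b$, and $0$ otherwise. A value distribution is a probability distribution $F$ on $\mathbb R$ whose support has lowest point $\underline v$ and highest point $\bar v$, $0\le\underline v<\bar v<\infty$; values are independent draws from $F$. A bidder $i$ with beliefs $(l_i,\mu_i,u_i)$ considers possible every vector $(B_j)_{j\ne i}$ of probability distributions on $\mathbb R_+$ with $B_j([l_i,u_i])=1$ and $\int x\,dB_j(x)=\mu_i$, the opponents bidding independently, $b_j\sim B_j$. For $B_{-i}=\prod_{j\neq i}B_j$, let $U_i(b,B_{-i})$ be the expected payoff of bid $b$; a bid is a minimax bid for value $v$ if it minimizes over $b\ge 0$ the maximal loss $\sup_{(B_j)}\bigl[\sup_{\tilde b\ge0}U_i(\tilde b,B_{-i})-U_i(b,B_{-i})\bigr]$. An (individual) moment equilibrium for $F$ consists of measurable strategies $\beta_i$ and beliefs $(l_i,\mu_i,u_i)$ such that $\beta_i(v)$ is a minimax bid for all $i$ and $v\in\operatorname{supp}F$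 and, for all $i$ and $j\neq i$, $\int\beta_i\,dF=\mu_j$, $\inf_{\operatorname{supp}F}\beta_i=l_j$ and $\sup_{\operatorname{supp}F}\beta_i=u_j$. It is separating if the $\beta_i$ are minimax bidding functions on all of $[\underline v,\bar v]$ that are strictly increasing in $v\in[\underline v,\bar v]$. $G$ is its bid distribution if $\beta_i(V)\sim G$ for $V\sim F$ and every $i$. For $l<\mu<u$ the function $\beta^{\mathrm{IND}}(v\mid l,\mu,u)$ is defined as follows. If $n=2$, put $\hat v_1=\frac{u(\mu-l)+\mu(u-\mu)}{u-l}$, $\hat v_2=\frac{u(u-l)-l(u-\mu)}{\mu-l}$ and $$\beta^{\mathrm{IND}}(v\mid l,\mu,u)=\begin{cases}u-\sqrt{(u-l)(u-v)}& v<\hat v_1,\\ l+\frac{-(\mu-l)(u-l)+\sqrt{(\mu-l)(u-l)\left((4v-3l)(u-\mu)+u(\mu-l)-l(u-l)\right)}}{2(u-\mu)}&\hat v_1\le v<\hat v_2,\\ u& v\ge\hat v_2.\end{cases}$$ If $n\ge3$, put $\tilde x_1(b)=\max\{l,\min\{\mu,\frac{(n-1)b-u}{n-2}\}\}$ and $\beta^{\mathrm{IND}}(v\mid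 l,\mu,u)=\min\{b,u\}$, where, if $v\le\mu+(\mu-\tilde x_1(\mu))\bigl(\frac{u-\mu}{u-\tilde x_1(\mu)}\bigr)^{n-1}$, $b$ is the solution in $[l,\mu]$ of $$\Bigl(\tfrac{u-\mu}{u-\tilde x_1(b)}\Bigr)^{n-1}(b-\tilde x_1(b))=\Bigl(\tfrac{u-\mu}{u-b}\Bigr)^{n-1}(v-b),$$ and for higher $v$, $b$ is the solution in $[\mu,\infty)$ of $$\Bigl(\tfrac{u-\mu}{u-\tilde x_1(b)}\Bigr)^{n-1}(b-\tilde x_1(b))=(v-b)\Bigl(1-\bigl(\tfrac{b-\mu}{b-l}\bigr)^{n-1}\Bigr).$$ **Theorem.** Let $G$ be a probability distribution on $\mathbb R_+$ whose support has lowest point $l$ and highest point $u$, with mean $\mu=\int b\,dG(b)$. There is a value distribution $F$ such that $G$ is the bid distribution of a separating individual moment equilibrium if and only if $l<\mu<u$. Moreover, when such an $F$ exists, it is unique, and with $\underline v,\bar v$ the lowest and highest points of its support the distribution functions satisfy $$F(v)=G(\beta^{\mathrm{IND}}(v\mid l,\mu,u))\qquad\text{for all }v\in[\underline v,\bar v];$$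 if the support of $G$ is the whole interval $[l,u]$, then the support of $F$ is the whole interval $[\underline v,\bar v]$. -/

import Mathlib

open MeasureTheory ProbabilityTheory

noncomputable section

namespace MomentEq

/-- The bid profile in which bidder `i` bids `b` and every other bidder `j` bids `x j`. -/
def profile {n : ℕ} (i : Fin n) (b : ℝ) (x : {j : Fin n // j ≠ i} → ℝ) : Fin n → ℝ :=
  fun j => if h : j = i then b else x ⟨j, h⟩

open Classical in
/-- Payoff of bidder `i` with value `v` in the first-price auction at the bid profile `b`:
the highest bid wins and pays, ties are broken uniformly, losing gives `0`. -/
def payoff {n : ℕ} (i : Fin n) (v : ℝ) (b : Fin n → ℝ) : ℝ :=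
  if ∀ j, b j ≤ b i then
    (v - b i) / ((Finset.univ.filter fun j : Fin n => b j = b i).card : ℝ)
  else 0

/-- Expected utility of bid `b` against independent opponent bids `b_j ∼ B j`, `j ≠ i`. -/
def expUtility {n : ℕ} (i : Fin n) (v b : ℝ) (B : {j : Fin n // j ≠ i} → Measure ℝ) : ℝ :=
  ∫ x, payoff i v (profile i b x) ∂(Measure.pi B)

/-- Loss of bid `b`: the highest expected utility over nonnegative bids minus the expected
utility of `b`. (For probability measures the supremum is over a set bounded by `max v 0`.) -/
def loss {n : ℕ} (i : Fin n) (v b : ℝ) (B : {j : Fin n // j ≠ i} → Measure ℝ) : ℝ :=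
  (⨆ b' : Set.Ici (0 : ℝ), expUtility i v (b' : ℝ) B) - expUtility i v b B

/-- The distributions of a single opponent's bid that a bidder with beliefs `(l, μ, u)` deems
possible: probability measures on `ℝ₊` with mass one on `[l, u]` and mean `μ`. -/
def beliefSet (l μ u : ℝ) : Set (Measure ℝ) :=
  {B | IsProbabilityMeasure B ∧ B (Set.Ici 0) = 1 ∧ B (Set.Icc l u) = 1 ∧ ∫ x, x ∂B = μ}

/-- The possible opponent bid distributions of bidder `i`: one element of `beliefSet l μ u` for
each opponent (not necessarily the same one). -/
def jointBeliefSet {n : ℕ} (i : Fin n) (l μ u : ℝ) : Set ({j : Fin n // j ≠ i} → Measure ℝ) :=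
  {B | ∀ j, B j ∈ beliefSet l μ u}

/-- Maximal loss of bid `b` over the belief set. (The losses are bounded by
`|v| + |v - b|`, so this is a genuine supremum.) -/
def maxLoss {n : ℕ} (i : Fin n) (l μ u v b : ℝ) : ℝ :=
  ⨆ B : jointBeliefSet i l μ u, loss i v b (B : {j : Fin n // j ≠ i} → Measure ℝ)

/-- `b` minimizes the maximal loss over all nonnegative bids. -/
def IsMinimaxBid {n : ℕ} (i : Fin n) (l μ u v b : ℝ) : Prop :=
  0 ≤ b ∧ ∀ b', 0 ≤ b' → maxLoss i l μ u v b ≤ maxLoss i l μ u v b'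

/-- `F` is a value distribution whose support has lowest point `vlo` and highest point `vhi`,
`0 ≤ vlo < vhi < ∞`. -/
structure IsValueDistribution (F : Measure ℝ) (vlo vhi : ℝ) : Prop where
  prob : IsProbabilityMeasure F
  least : IsLeast F.support vlo
  greatest : IsGreatest F.support vhi
  nonneg : 0 ≤ vlo
  lt : vlo < vhi

/-- `(β, l, μ, u)` is an (individual) moment equilibrium for the value distribution `F`.
Only the restrictions of the strategies to `supp F` matter here. -/
structure IsMomentEquilibrium {n : ℕ} (F : Measure ℝ) (β : Fin n → ℝ → ℝ)
    (l μ u : Fin n → ℝ) : Prop where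
  measurable : ∀ i, Measurable (β i)
  optimal : ∀ i, ∀ v ∈ F.support, IsMinimaxBid i (l i) (μ i) (u i) v (β i v)
  mean_consistent : ∀ i j, j ≠ i → ∫ v, β i v ∂F = μ j
  lower_consistent : ∀ i j, j ≠ i → IsGLB (β i '' F.support) (l j)
  upper_consistent : ∀ i j, j ≠ i → IsLUB (β i '' F.support) (u j)

/-- Beliefs and bidding functions are separating on the range of values `[vlo, vhi]`: the
bidding functions prescribe minimax bids there and are strictly increasing in the value. -/
def IsSeparating {n : ℕ} (β : Fin n → ℝ → ℝ) (l μ u : Fin n → ℝ) (vlo vhi : ℝ) : Prop :=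
  ∀ i, (∀ v ∈ Set.Icc vlo vhi, IsMinimaxBid i (l i) (μ i) (u i) v (β i v)) ∧
    StrictMonoOn (β i) (Set.Icc vlo vhi)

/-- `F` is a value distribution for which `G` is the bid distribution (of every bidder) of a
separating moment equilibrium with `n` bidders. -/
def Rationalizes (n : ℕ) (F G : Measure ℝ) : Prop :=
  ∃ vlo vhi : ℝ, IsValueDistribution F vlo vhi ∧
    ∃ (β : Fin n → ℝ → ℝ) (l μ u : Fin n → ℝ),
      IsMomentEquilibrium F β l μ u ∧ IsSeparating β l μ u vlo vhi ∧
        ∀ i, F.map (β i) = G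

/-- `x̃₁(b) = max {l, min {μ, ((n-1) b - u) / (n-2)}}`, for `n ≥ 3`. -/
def xTilde (n : ℕ) (l μ u b : ℝ) : ℝ :=
  max l (min μ ((((n : ℝ) - 1) * b - u) / ((n : ℝ) - 2)))

/-- Maximal loss from bidding too high, for `n ≥ 3`. -/
def lossHigh (n : ℕ) (l μ u b : ℝ) : ℝ :=
  ((u - μ) / (u - xTilde n l μ u b)) ^ (n - 1) * (b - xTilde n l μ u b)

/-- The cutoff value below which the minimax bid is below `μ`, for `n ≥ 3`. -/
def cutoff (n : ℕ) (l μ u : ℝ) : ℝ :=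
  μ + (μ - xTilde n l μ u μ) * ((u - μ) / (u - xTilde n l μ u μ)) ^ (n - 1)

/-- The equation that determines the (uncapped) bid `b` of value `v`, for `n ≥ 3`. Low values
bid in `[l, μ]` and high values bid at least `μ`; on these ranges the solution is unique. -/
def BidEquation (n : ℕ) (l μ u v b : ℝ) : Prop :=
  if v ≤ cutoff n l μ u then
    b ∈ Set.Icc l μ ∧ lossHigh n l μ u b = ((u - μ) / (u - b)) ^ (n - 1) * (v - b)
  else
    μ ≤ b ∧ lossHigh n l μ u b = (v - b) * (1 - ((b - μ) / (b - l)) ^ (n - 1))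

/-- First cutoff value for two bidders. -/
def vHat₁ (l μ u : ℝ) : ℝ := (u * (μ - l) + μ * (u - μ)) / (u - l)

/-- Second cutoff value for two bidders. -/
def vHat₂ (l μ u : ℝ) : ℝ := (u * (u - l) - l * (u - μ)) / (μ - l)

open Classical in
/-- The bidding function for two bidders, in closed form. -/
def betaTwo (l μ u v : ℝ) : ℝ :=
  if v < vHat₁ l μ u then u - Real.sqrt ((u - l) * (u - v))
  else if v < vHat₂ l μ u then
    l + (-((μ - l) * (u - l)) +
      Real.sqrt ((μ - l) * (u - l) *
        ((4 * v - 3 * l) * (u - μ) + u * (μ - l) - l * (u - l)))) / (2 * (u - μ))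
  else u

open Classical in
/-- The bidding function `β^IND(v | l, μ, u)` with `n` bidders: the closed form for `n = 2`, and
`min {b, u}` for the solution `b` of the bid equation for `n ≥ 3`. -/
def betaIND (n : ℕ) (l μ u v : ℝ) : ℝ :=
  if n = 2 then betaTwo l μ u v
  else min (Classical.epsilon fun b : ℝ => BidEquation n l μ u v b) u

end MomentEq

end

noncomputable section

namespace MomentEq

/-! ### Payoffs at a fixed bid profile -/

section Payoff

variable {n : ℕ} {i : Fin n} {v b : ℝ} {x : {j : Fin n // j ≠ i} → ℝ}

/-! Fix beliefs with l < μ < u. Everything rests on `valueOf`, which sends a bid b in [l, u] to the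
value v at which the two ways of regretting b are equally bad. Bidding too high costs at worst
`lossHigh`, whatever the value: each opponent bids some x or u, and a bid just above x would have
won with the same probability. Bidding too low costs at worst v - b times `probLow μ u b ^ (n - 1)`
if b ≤ μ, and times `1 - probBelow l μ b ^ (n - 1)` if b ≥ μ. Markov's inequality yields the upper
bounds, and two-point laws approach them.

At v = `valueOf n l μ u b` the two worst losses agree (`maxLoss_valueOf_le`), and any other bid has
a strictly larger maximal loss (`lossHigh_lt_maxLoss`), except that for b = l bids below l do
equally well. So b is the minimax bid of v, essentially the only one. Uniqueness makes `valueOf`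
injective, and continuity then makes it strictly increasing; no derivative is needed.

For existence, G is pushed forward along `valueOf`. Conversely, consistency and the common bid law
force every bidder's beliefs to be (l, μ, u), and strictly increasing bids put the mean strictly
between l and u. Strictness also excludes values stuck at the bid u, so `valueOf` undoes each
strategy and F must be the pushforward (`Rationalizes.eq_map_valueOf`). The formula for the
distribution function follows because `betaIND` inverts `valueOf` (`betaIND_valueOf`). -/

lemma profile_self : profile i b x i = b := by simp [profile]

lemma profile_coe (j : {j : Fin n // j ≠ i}) : profile i b x j = x j := by
  simp [profile, j.2]

lemma forall_profile_le_iff : (∀ j, profile i b x j ≤ profile i b x i) ↔ ∀ j, x j ≤ b := by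
  rw [profile_self]
  refine ⟨fun h j => by simpa only [profile_coe] using h j, fun h j => ?_⟩
  by_cases hj : j = i
  · subst hj; rw [profile_self]
  · have := h ⟨j, hj⟩
    rwa [← profile_coe (b := b) (x := x)] at this

lemma payoff_eq_zero (h : ¬ ∀ j, x j ≤ b) : payoff i v (profile i b x) = 0 := by
  rw [payoff, if_neg (by rwa [forall_profile_le_iff])]

lemma exists_payoff_eq (h : ∀ j, x j ≤ b) :
    ∃ k : ℝ, 1 ≤ k ∧ payoff i v (profile i b x) = (v - b) / k := by
  classical
  refine ⟨_, ?_, by rw [payoff, if_pos (forall_profile_le_iff.2 h), profile_self]⟩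
  have : 0 < (Finset.univ.filter fun j : Fin n => profile i b x j = b).card :=
    Finset.card_pos.2 ⟨i, by simp [profile_self]⟩
  exact_mod_cast this

lemma payoff_of_forall_lt (h : ∀ j, x j < b) : payoff i v (profile i b x) = v - b := by
  classical
  rw [payoff, if_pos (forall_profile_le_iff.2 fun j => (h j).le), profile_self]
  have : (Finset.univ.filter fun j : Fin n => profile i b x j = b) = {i} := by
    ext j
    simp only [Finset.mem_filter, Finset.mem_univ, true_and, Finset.mem_singleton]
    refine ⟨fun hj => ?_, fun hj => by rw [hj, profile_self]⟩
    by_contra hne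
    have h1 := h ⟨j, hne⟩
    rw [← profile_coe (b := b) (x := x)] at h1
    exact h1.ne hj
  rw [show ((Finset.univ.filter fun j : Fin n => profile i b x j = b).card : ℝ) = 1 by
    rw [this]; simp]
  simp

lemma payoff_nonneg (hv : b ≤ v) : 0 ≤ payoff i v (profile i b x) := by
  by_cases h : ∀ j, x j ≤ b
  · obtain ⟨k, hk, hp⟩ := exists_payoff_eq (v := v) h
    rw [hp]
    exact div_nonneg (by linarith) (by linarith)
  · rw [payoff_eq_zero h]

lemma payoff_nonpos (hv : v ≤ b) : payoff i v (profile i b x) ≤ 0 := by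
  by_cases h : ∀ j, x j ≤ b
  · obtain ⟨k, hk, hp⟩ := exists_payoff_eq (v := v) h
    rw [hp]
    exact div_nonpos_of_nonpos_of_nonneg (by linarith) (by linarith)
  · rw [payoff_eq_zero h]

/-- Counting every tie as a win overstates the payoff; `le_payoff` counts every tie as a loss.
Between them the number of tied bidders drops out of the later estimates. -/
lemma payoff_le (hv : b ≤ v) :
    payoff i v (profile i b x) ≤ (Set.univ.pi fun _ => Set.Iic b).indicator (fun _ => v - b) x := by
  by_cases h : ∀ j, x j ≤ b
  · obtain ⟨k, hk, hp⟩ := exists_payoff_eq (v := v) h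
    rw [hp, Set.indicator_of_mem
      (show x ∈ Set.univ.pi fun _ => Set.Iic b from Set.mem_univ_pi.2 h)]
    exact div_le_self (by linarith) hk
  · rw [payoff_eq_zero h, Set.indicator_of_notMem
      (show x ∉ Set.univ.pi fun _ => Set.Iic b from mt Set.mem_univ_pi.1 h)]

lemma le_payoff (hv : b ≤ v) :
    (Set.univ.pi fun _ => Set.Iio b).indicator (fun _ => v - b) x ≤ payoff i v (profile i b x) := by
  by_cases h : ∀ j, x j < b
  · rw [payoff_of_forall_lt h, Set.indicator_of_mem
      (show x ∈ Set.univ.pi fun _ => Set.Iio b from Set.mem_univ_pi.2 h)]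
  · rw [Set.indicator_of_notMem
      (show x ∉ Set.univ.pi fun _ => Set.Iio b from mt Set.mem_univ_pi.1 h)]
    exact payoff_nonneg hv

lemma payoff_eq_indicator (hx : ∀ j, x j ≠ b) :
    payoff i v (profile i b x) =
      (Set.univ.pi fun _ => Set.Iio b).indicator (fun _ => v - b) x := by
  by_cases h : ∀ j, x j < b
  · rw [payoff_of_forall_lt h, Set.indicator_of_mem
      (show x ∈ Set.univ.pi fun _ => Set.Iio b from Set.mem_univ_pi.2 h)]
  · rw [Set.indicator_of_notMem
      (show x ∉ Set.univ.pi fun _ => Set.Iio b from mt Set.mem_univ_pi.1 h),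
      payoff_eq_zero fun h' => h fun j => lt_of_le_of_ne (h' j) (hx j)]

lemma abs_payoff_le : |payoff i v (profile i b x)| ≤ |v - b| := by
  by_cases h : ∀ j, x j ≤ b
  · obtain ⟨k, hk, hp⟩ := exists_payoff_eq (v := v) h
    rw [hp, abs_div, abs_of_pos (show 0 < k by linarith)]
    exact div_le_self (abs_nonneg _) hk
  · rw [payoff_eq_zero h, abs_zero]
    exact abs_nonneg _

lemma measurable_payoff (i : Fin n) (v b : ℝ) :
    Measurable fun x : {j : Fin n // j ≠ i} → ℝ => payoff i v (profile i b x) := by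
  classical
  have hp : ∀ j, Measurable fun x : {j : Fin n // j ≠ i} → ℝ => profile i b x j := by
    intro j
    by_cases hj : j = i
    · simp [profile, hj]
    · simpa [profile, hj] using measurable_pi_apply _
  unfold payoff
  refine Measurable.ite ?_ ?_ measurable_const
  · rw [Set.ofPred_forall]
    exact MeasurableSet.iInter fun j => measurableSet_le (hp j) (hp i)
  · refine (measurable_const.sub (hp i)).div ?_
    have : (fun x : {j : Fin n // j ≠ i} → ℝ =>
        ((Finset.univ.filter fun j => profile i b x j = profile i b x i).card : ℝ)) =
        fun x => ∑ j, if profile i b x j = profile i b x i then (1 : ℝ) else 0 := by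
      ext x
      rw [Finset.card_filter]
      push_cast
      rfl
    convert this ▸ Finset.measurable_sum Finset.univ fun j _ =>
      Measurable.ite (measurableSet_eq_fun (hp j) (hp i)) measurable_const measurable_const

end Payoff

/-! ### Expected utility and loss against fixed opponents -/

section ExpUtility

variable {n : ℕ} {i : Fin n} {v b : ℝ} {B : {j : Fin n // j ≠ i} → Measure ℝ}

lemma expUtility_nonneg (hv : b ≤ v) : 0 ≤ expUtility i v b B :=
  integral_nonneg fun _ => payoff_nonneg hv

lemma expUtility_nonpos (hv : v ≤ b) : expUtility i v b B ≤ 0 :=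
  integral_nonpos fun _ => payoff_nonpos hv

lemma loss_le {m : ℝ} (h : ∀ b', 0 ≤ b' → expUtility i v b' B - expUtility i v b B ≤ m) :
    loss i v b B ≤ m := by
  have : (⨆ b' : Set.Ici (0 : ℝ), expUtility i v (b' : ℝ) B) ≤ m + expUtility i v b B :=
    ciSup_le fun c => by linarith [h c c.2]
  rw [loss]
  linarith

variable [∀ j, IsProbabilityMeasure (B j)]

lemma integrable_payoff (i : Fin n) (v b : ℝ) (B : {j : Fin n // j ≠ i} → Measure ℝ)
    [∀ j, IsProbabilityMeasure (B j)] :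
    Integrable (fun x => payoff i v (profile i b x)) (Measure.pi B) :=
  Integrable.of_bound (measurable_payoff i v b).aestronglyMeasurable |v - b|
    (Filter.Eventually.of_forall fun _ => abs_payoff_le)

lemma integral_indicator_pi {s : Set ℝ} (hs : MeasurableSet s) (c : ℝ) :
    ∫ x, (Set.univ.pi fun _ => s).indicator (fun _ => c) x ∂(Measure.pi B) =
      c * ∏ j, (B j).real s := by
  rw [integral_indicator_const _ (MeasurableSet.univ_pi fun _ => hs), measureReal_def,
    Measure.pi_pi, ENNReal.toReal_prod, smul_eq_mul, mul_comm]
  rfl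

lemma integrable_indicator_pi {s : Set ℝ} (hs : MeasurableSet s) (c : ℝ) :
    Integrable ((Set.univ.pi fun _ => s).indicator fun _ => c) (Measure.pi B) :=
  (integrable_const c).indicator (MeasurableSet.univ_pi fun _ => hs)

lemma expUtility_le (hv : b ≤ v) :
    expUtility i v b B ≤ (v - b) * ∏ j, (B j).real (Set.Iic b) := by
  rw [← integral_indicator_pi measurableSet_Iic]
  exact integral_mono (integrable_payoff i v b B) (integrable_indicator_pi measurableSet_Iic _)
    fun _ => payoff_le hv

lemma le_expUtility (hv : b ≤ v) :
    (v - b) * ∏ j, (B j).real (Set.Iio b) ≤ expUtility i v b B := by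
  rw [← integral_indicator_pi measurableSet_Iio]
  exact integral_mono (integrable_indicator_pi measurableSet_Iio _) (integrable_payoff i v b B)
    fun _ => le_payoff hv

/-- Without atoms at the bid, ties have probability zero. This is why the later lower bounds move
bids slightly off the atoms and pass to a limit. -/
lemma expUtility_eq (hb : ∀ j, B j {b} = 0) :
    expUtility i v b B = (v - b) * ∏ j, (B j).real (Set.Iio b) := by
  rw [← integral_indicator_pi measurableSet_Iio]
  refine integral_congr_ae ?_
  have : ∀ᵐ x ∂(Measure.pi B), ∀ j, x j ≠ b := by
    rw [ae_all_iff]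
    intro j
    have h := (measurePreserving_eval B j).measure_preimage
      (measurableSet_singleton b).nullMeasurableSet
    rw [hb j] at h
    rw [ae_iff]
    convert h using 2
    ext x
    simp
  filter_upwards [this] with x hx using payoff_eq_indicator hx

lemma abs_expUtility_le : |expUtility i v b B| ≤ |v - b| := by
  have := norm_integral_le_of_norm_le_const (μ := Measure.pi B)
    (f := fun x => payoff i v (profile i b x))
    (Filter.Eventually.of_forall fun _ => abs_payoff_le)
  rwa [probReal_univ, mul_one] at this

lemma expUtility_le_max (hb : 0 ≤ b) : expUtility i v b B ≤ max v 0 := by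
  rcases le_total b v with h | h
  · have := (abs_le.1 (abs_expUtility_le (i := i) (v := v) (b := b) (B := B))).2
    rw [abs_of_nonneg (by linarith)] at this
    exact le_max_of_le_left (by linarith)
  · exact le_max_of_le_right (expUtility_nonpos h)

lemma sub_le_loss {b' : ℝ} (hb' : 0 ≤ b') :
    expUtility i v b' B - expUtility i v b B ≤ loss i v b B := by
  have hbdd : BddAbove (Set.range fun b' : Set.Ici (0 : ℝ) => expUtility i v (b' : ℝ) B) := by
    refine ⟨max v 0, ?_⟩
    rintro _ ⟨c, rfl⟩
    exact expUtility_le_max c.2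
  exact sub_le_sub_right (le_ciSup hbdd ⟨b', hb'⟩) _

end ExpUtility

/-! ### Bounding the maximal loss from either side -/

section MaxLoss

variable {n : ℕ} {i : Fin n} {l μ u v b : ℝ}

lemma sub_le_maxLoss {B : {j : Fin n // j ≠ i} → Measure ℝ} (hB : B ∈ jointBeliefSet i l μ u)
    {b' : ℝ} (hb' : 0 ≤ b') :
    expUtility i v b' B - expUtility i v b B ≤ maxLoss i l μ u v b := by
  have : ∀ j, IsProbabilityMeasure (B j) := fun j => (hB j).1
  refine (sub_le_loss hb').trans ?_
  have hbdd : BddAbove (Set.range fun B : jointBeliefSet i l μ u =>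
      loss i v b (B : {j : Fin n // j ≠ i} → Measure ℝ)) := by
    refine ⟨max v 0 + |v - b|, ?_⟩
    rintro _ ⟨C, rfl⟩
    have : ∀ j, IsProbabilityMeasure (C.1 j) := fun j => (C.2 j).1
    refine loss_le fun c hc => ?_
    have h1 := expUtility_le_max (i := i) (v := v) (B := C.1) hc
    have h2 := (abs_le.1 (abs_expUtility_le (i := i) (v := v) (b := b) (B := C.1))).1
    linarith
  exact le_ciSup hbdd ⟨B, hB⟩

lemma maxLoss_le {m : ℝ} (hne : (jointBeliefSet i l μ u).Nonempty)
    (h : ∀ B ∈ jointBeliefSet i l μ u, ∀ b', 0 ≤ b' →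
      expUtility i v b' B - expUtility i v b B ≤ m) :
    maxLoss i l μ u v b ≤ m := by
  have := hne.to_subtype
  exact ciSup_le fun C => loss_le fun c hc => h C.1 C.2 c hc

end MaxLoss

/-! ### Laws with given range and mean: Markov bounds and two-point laws -/

section Belief

variable {l μ u b : ℝ} {B : Measure ℝ}

lemma ae_mem_Icc_of_mem_beliefSet (hB : B ∈ beliefSet l μ u) : ∀ᵐ x ∂B, x ∈ Set.Icc l u := by
  have := hB.1
  exact (prob_compl_eq_zero_iff measurableSet_Icc).2 hB.2.2.1

lemma integrable_id_of_mem_beliefSet (hB : B ∈ beliefSet l μ u) :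
    Integrable (fun x : ℝ => x) B := by
  have := hB.1
  refine Integrable.of_bound measurable_id.aestronglyMeasurable (max |l| |u|) ?_
  filter_upwards [ae_mem_Icc_of_mem_beliefSet hB] with x hx
  exact abs_le_max_abs_abs hx.1 hx.2

/-- Markov's inequality for the nonnegative variable u - x, whose mean is u - μ. -/
lemma real_Iic_le (hB : B ∈ beliefSet l μ u) (hb : b < u) :
    B.real (Set.Iic b) ≤ (u - μ) / (u - b) := by
  have := hB.1
  have hi := integrable_id_of_mem_beliefSet hB
  have h := mul_meas_ge_le_integral_of_nonneg (μ := B) (f := fun x => u - x)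
    (by filter_upwards [ae_mem_Icc_of_mem_beliefSet hB] with x hx; simpa using hx.2)
    ((integrable_const u).sub hi) (u - b)
  rw [integral_sub (integrable_const u) hi, hB.2.2.2] at h
  rw [le_div_iff₀ (by linarith), mul_comm]
  have hs : {x : ℝ | u - b ≤ u - x} = Set.Iic b := by ext x; simp only [Set.mem_ofPred_eq, Set.mem_Iic]; constructor <;> intro _ <;> linarith
  rw [hs] at h
  simpa using h

/-- Markov's inequality for x - l bounds the complementary event. -/
lemma le_real_Iio (hB : B ∈ beliefSet l μ u) (hb : l < b) :
    (b - μ) / (b - l) ≤ B.real (Set.Iio b) := by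
  have := hB.1
  have hi := integrable_id_of_mem_beliefSet hB
  have h := mul_meas_ge_le_integral_of_nonneg (μ := B) (f := fun x => x - l)
    (by filter_upwards [ae_mem_Icc_of_mem_beliefSet hB] with x hx; simpa using hx.1)
    (hi.sub (integrable_const l)) (b - l)
  rw [integral_sub hi (integrable_const l), hB.2.2.2] at h
  have hs : {x : ℝ | b - l ≤ x - l} = (Set.Iio b)ᶜ := by ext x; simp
  rw [hs, probReal_compl_eq_one_sub measurableSet_Iio] at h
  simp only [integral_const, probReal_univ, smul_eq_mul, one_mul] at h
  rw [div_le_iff₀ (by linarith)]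
  linarith

lemma real_Iic_eq_zero (hB : B ∈ beliefSet l μ u) (hb : b < l) : B.real (Set.Iic b) = 0 := by
  have := hB.1
  rw [measureReal_eq_zero_iff]
  refine measure_mono_null ?_ ((prob_compl_eq_zero_iff measurableSet_Icc).2 hB.2.2.1)
  intro x hx hx'
  exact absurd (hx'.1.trans hx) (by simpa using hb)

/-- The law of a bid that is `x` with probability `p` and `y` otherwise. -/
def twoPoint (p x y : ℝ) : Measure ℝ :=
  ENNReal.ofReal p • Measure.dirac x + ENNReal.ofReal (1 - p) • Measure.dirac y

lemma isProbabilityMeasure_twoPoint {p : ℝ} (x y : ℝ) (h0 : 0 ≤ p) (h1 : p ≤ 1) :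
    IsProbabilityMeasure (twoPoint p x y) :=
  ⟨by simp [twoPoint, ← ENNReal.ofReal_add h0 (sub_nonneg.2 h1)]⟩

lemma twoPoint_mem_beliefSet {p x y : ℝ} (h0 : 0 ≤ p) (h1 : p ≤ 1) (hl : 0 ≤ l)
    (hx : x ∈ Set.Icc l u) (hy : y ∈ Set.Icc l u) (hm : p * x + (1 - p) * y = μ) :
    twoPoint p x y ∈ beliefSet l μ u := by
  have h1' := sub_nonneg.2 h1
  have hx0 : 0 ≤ x := hl.trans hx.1
  have hy0 : 0 ≤ y := hl.trans hy.1
  refine ⟨isProbabilityMeasure_twoPoint x y h0 h1, ?_, ?_, ?_⟩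
  · simp [twoPoint, measurableSet_Ici, Set.indicator, hx0, hy0, ← ENNReal.ofReal_add h0 h1']
  · simp [twoPoint, measurableSet_Icc, Set.indicator, hx.1, hx.2, hy.1, hy.2,
      ← ENNReal.ofReal_add h0 h1']
  · have hi : ∀ (q z : ℝ), Integrable (fun x : ℝ => x) (ENNReal.ofReal q • Measure.dirac z) :=
      fun q z => (integrable_dirac (by simp)).smul_measure ENNReal.ofReal_ne_top
    rw [twoPoint, integral_add_measure (hi _ _) (hi _ _)]
    simp [integral_smul_measure, ENNReal.toReal_ofReal h0, ENNReal.toReal_ofReal h1', hm]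

open Classical in
lemma twoPoint_real_Iio {p x y : ℝ} (h0 : 0 ≤ p) (h1 : p ≤ 1) :
    (twoPoint p x y).real (Set.Iio b) =
      (if x < b then p else 0) + (if y < b then 1 - p else 0) := by
  have h1' := sub_nonneg.2 h1
  rw [measureReal_def, twoPoint]
  by_cases hx : x < b <;> by_cases hy : y < b <;>
    simp [measurableSet_Iio, Set.indicator, hx, hy, h0, h1', ← ENNReal.ofReal_add h0 h1']

lemma twoPoint_singleton {p x y : ℝ} (hx : b ≠ x) (hy : b ≠ y) : twoPoint p x y {b} = 0 := by
  simp [twoPoint, hx.symm, hy.symm]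

-- The source of all strict lower bounds on the maximal loss: every opponent draws from the same
-- two-point law. Keeping both bids off the atoms makes the winning probabilities exact powers.
open Classical in
lemma twoPoint_le_maxLoss {n : ℕ} {i : Fin n} {v b' p x y : ℝ} (h0 : 0 ≤ p) (h1 : p ≤ 1)
    (hl : 0 ≤ l) (hx : x ∈ Set.Icc l u) (hy : y ∈ Set.Icc l u) (hm : p * x + (1 - p) * y = μ)
    (hb' : 0 ≤ b') (hbx : b ≠ x) (hby : b ≠ y) (hbx' : b' ≠ x) (hby' : b' ≠ y) :
    (v - b') * ((if x < b' then p else 0) + (if y < b' then 1 - p else 0)) ^ (n - 1) -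
      (v - b) * ((if x < b then p else 0) + (if y < b then 1 - p else 0)) ^ (n - 1) ≤
        maxLoss i l μ u v b := by
  have hp := isProbabilityMeasure_twoPoint x y h0 h1
  have hB := twoPoint_mem_beliefSet h0 h1 hl hx hy hm
  have hc : Fintype.card {j : Fin n // j ≠ i} = n - 1 := by simp
  have key : ∀ c, c ≠ x → c ≠ y → expUtility i v c (fun _ => twoPoint p x y) =
      (v - c) * ((if x < c then p else 0) + (if y < c then 1 - p else 0)) ^ (n - 1) := by
    intro c hcx hcy
    rw [expUtility_eq fun _ => twoPoint_singleton hcx hcy, Finset.prod_const,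
      Finset.card_univ, hc, twoPoint_real_Iio h0 h1]
  rw [← key b' hbx' hby', ← key b hbx hby]
  exact sub_le_maxLoss (fun _ => hB) hb'

lemma jointBeliefSet_nonempty {n : ℕ} {i : Fin n} (hl : 0 ≤ l) (hlμ : l ≤ μ) (hμu : μ ≤ u) :
    (jointBeliefSet i l μ u).Nonempty :=
  ⟨fun _ => twoPoint 1 μ μ, fun _ => twoPoint_mem_beliefSet zero_le_one le_rfl hl
    ⟨hlμ, hμu⟩ ⟨hlμ, hμu⟩ (by ring)⟩

end Belief

/-! ### First-order conditions made global by Bernoulli's inequality -/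

section Bernoulli

variable {N : ℕ} {T D s : ℝ}

lemma mul_linear_mul_pow_le (hT : 0 ≤ T) (hD : 0 < D) (hs : s ≤ D) :
    (T - s + s * (D - N * T) / D) * D ^ N ≤ T * (D - s) ^ N := by
  have h1 : -2 ≤ -(s / D) := by
    have : s / D ≤ 1 := (div_le_one hD).2 hs
    linarith
  have h2 := one_add_mul_le_pow h1 N
  have h3 : (D - s) ^ N = D ^ N * (1 + -(s / D)) ^ N := by
    rw [← mul_pow]
    congr 1
    field_simp
    ring
  calc (T - s + s * (D - N * T) / D) * D ^ N = T * (1 + N * -(s / D)) * D ^ N := by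
        field_simp
        ring
    _ ≤ T * (1 + -(s / D)) ^ N * D ^ N := by gcongr
    _ = T * (D - s) ^ N := by rw [h3]; ring

/-- For s < D this compares (T - s) / (D - s) ^ N with its value at s = 0. The derivative there has
the sign of N T - D, so `h` is only a first-order condition in the direction of s; Bernoulli's
inequality for (1 - s / D) ^ N makes it global. -/
lemma sub_mul_pow_le (hT : 0 ≤ T) (hD : 0 < D) (hs : s ≤ D) (h : 0 ≤ s * (D - N * T)) :
    (T - s) * D ^ N ≤ T * (D - s) ^ N := by
  refine le_trans ?_ (mul_linear_mul_pow_le hT hD hs)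
  gcongr
  exact le_add_of_nonneg_right (div_nonneg h hD.le)

lemma sub_mul_pow_lt (hT : 0 ≤ T) (hD : 0 < D) (hs : s ≤ D) (h : 0 < s * (D - N * T)) :
    (T - s) * D ^ N < T * (D - s) ^ N := by
  refine lt_of_lt_of_le ?_ (mul_linear_mul_pow_le hT hD hs)
  gcongr
  exact lt_add_of_pos_right _ (div_pos h hD)

end Bernoulli

/-- The highest probability of bids up to `x` for a bid distribution on `(-∞, u]` with
mean `μ`. -/
def probLow (μ u x : ℝ) : ℝ := (u - μ) / (u - x)

/-- The lowest probability of bids below `b` for a bid distribution on `[l, ∞)` with mean `μ`. -/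
def probBelow (l μ b : ℝ) : ℝ := (b - μ) / (b - l)

/-- The value that bids `b`: the inverse of the minimax bidding function. -/
def valueOf (n : ℕ) (l μ u b : ℝ) : ℝ :=
  b + lossHigh n l μ u b /
    (probLow μ u (min b μ) ^ (n - 1) * (1 - probBelow l μ (max b μ) ^ (n - 1)))

/-- At least two bidders, and beliefs that leave room for uncertainty. -/
structure IsNondegenerate (n : ℕ) (l μ u : ℝ) : Prop where
  two_le : 2 ≤ n
  nonneg : 0 ≤ l
  lt_mean : l < μ
  mean_lt : μ < u

/-! ### Extremal winning probabilities -/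

section Prob

variable {n : ℕ} {l μ u x b c : ℝ}

lemma probLow_mean (h : μ < u) : probLow μ u μ = 1 := div_self (by linarith)

lemma probLow_pos (h : μ < u) (hx : x ≤ μ) : 0 < probLow μ u x :=
  div_pos (by linarith) (by linarith)

lemma probLow_le_one (h : μ < u) (hx : x ≤ μ) : probLow μ u x ≤ 1 :=
  (div_le_one (by linarith)).2 (by linarith)

lemma probBelow_mean : probBelow l μ μ = 0 := by simp [probBelow]

lemma probBelow_nonneg (h : l < μ) (hb : μ ≤ b) : 0 ≤ probBelow l μ b :=
  div_nonneg (by linarith) (by linarith)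

lemma probBelow_lt_one (h : l < μ) (hb : μ ≤ b) : probBelow l μ b < 1 :=
  (div_lt_one (by linarith)).2 (by linarith)

lemma probBelow_lt_probBelow (h : l < μ) (hb : μ ≤ b) (hbc : b < c) :
    probBelow l μ b < probBelow l μ c := by
  rw [probBelow, probBelow, div_lt_div_iff₀ (by linarith) (by linarith)]
  nlinarith

lemma IsNondegenerate.pred_ne_zero (h : IsNondegenerate n l μ u) : n - 1 ≠ 0 := by
  have := h.two_le
  omega

lemma IsNondegenerate.one_sub_probBelow_pow_pos (h : IsNondegenerate n l μ u) (hb : μ ≤ b) :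
    0 < 1 - probBelow l μ b ^ (n - 1) :=
  sub_pos.2 (pow_lt_one₀ (probBelow_nonneg h.lt_mean hb) (probBelow_lt_one h.lt_mean hb)
    h.pred_ne_zero)

lemma IsNondegenerate.one_sub_probBelow_pow_lt (h : IsNondegenerate n l μ u) (hb : μ ≤ b)
    (hbc : b < c) : 1 - probBelow l μ c ^ (n - 1) < 1 - probBelow l μ b ^ (n - 1) :=
  sub_lt_sub_left (pow_lt_pow_left₀ (probBelow_lt_probBelow h.lt_mean hb hbc)
    (probBelow_nonneg h.lt_mean hb) h.pred_ne_zero) _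

end Prob

namespace IsNondegenerate

/-! ### The worst loss from bidding too high -/

section LossHigh

variable {n : ℕ} {l μ u : ℝ} {b x : ℝ}

lemma xTilde_mem (h : IsNondegenerate n l μ u) (b : ℝ) : xTilde n l μ u b ∈ Set.Icc l μ :=
  ⟨le_max_left _ _, max_le h.lt_mean.le (min_le_left _ _)⟩

/-- Division by n - 2 = 0 gives 0, and clamping then gives l because 0 ≤ l < μ. This is the right
maximizer: for two bidders and b ≤ u, (b - x) / (u - x) is nonincreasing in x. Both cases can thus
share `lossHigh`. -/
lemma xTilde_two (h : IsNondegenerate 2 l μ u) (b : ℝ) : xTilde 2 l μ u b = l := by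
  have h0 := h.nonneg
  have h1 := h.lt_mean
  rw [xTilde]
  norm_num
  exact Or.inr h0

lemma three_le (h : IsNondegenerate n l μ u) (hn : n ≠ 2) : 3 ≤ n := by
  have := h.two_le
  omega

lemma cast_pred (h : IsNondegenerate n l μ u) : ((n - 1 : ℕ) : ℝ) = (n : ℝ) - 1 := by
  have := h.two_le
  rw [Nat.cast_sub (by omega), Nat.cast_one]

lemma xTilde_first_order (h : IsNondegenerate n l μ u) (hb : b ≤ u) (hx : x ∈ Set.Icc l μ) :
    0 ≤ (x - xTilde n l μ u b) *
      ((u - xTilde n l μ u b) - (n - 1 : ℕ) * (b - xTilde n l μ u b)) := by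
  obtain ⟨hx1, hx2⟩ := hx
  by_cases hn : n = 2
  · subst hn
    rw [h.xTilde_two]
    norm_num
    exact mul_nonneg (by linarith) (by linarith)
  · have h3 : (3 : ℝ) ≤ n := by exact_mod_cast h.three_le hn
    rw [h.cast_pred, xTilde]
    set c := (((n : ℝ) - 1) * b - u) / ((n : ℝ) - 2) with hc
    have hk : ((n : ℝ) - 2) * c = ((n : ℝ) - 1) * b - u := by
      rw [hc]
      field_simp [show (n : ℝ) - 2 ≠ 0 by linarith]
    set y := max l (min μ c) with hy
    -- Here c is the unconstrained critical point and y its projection to [l, μ], so x - y and y - c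
    -- never have opposite signs for x in that interval.
    have e : (u - y) - ((n : ℝ) - 1) * (b - y) = ((n : ℝ) - 2) * (y - c) := by linarith
    rw [e, mul_left_comm]
    refine mul_nonneg (by linarith) ?_
    rcases le_total c l with h1 | h1
    · have : y = l := by rw [hy, max_eq_left ((min_le_right _ _).trans h1)]
      rw [this]
      exact mul_nonneg (by linarith) (by linarith)
    · rcases le_total c μ with h2 | h2
      · have : y = c := by rw [hy, min_eq_right h2, max_eq_right h1]
        simp [this]
      · have : y = μ := by rw [hy, min_eq_left h2, max_eq_right h.lt_mean.le]
        rw [this]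
        exact mul_nonneg_of_nonpos_of_nonpos (by linarith) (by linarith)

lemma xTilde_lt (h : IsNondegenerate n l μ u) (hlb : l < b) (hb : b ≤ u) :
    xTilde n l μ u b < b := by
  by_cases hn : n = 2
  · subst hn
    rwa [h.xTilde_two]
  · have h3 : (3 : ℝ) ≤ n := by exact_mod_cast h.three_le hn
    refine max_lt hlb ?_
    rcases hb.lt_or_eq with hb | rfl
    · refine (min_le_right _ _).trans_lt ?_
      rw [div_lt_iff₀ (by linarith)]
      linarith
    · exact (min_le_left _ _).trans_lt h.mean_lt

lemma xTilde_of_le (h : IsNondegenerate n l μ u) (hb : b ≤ l) : xTilde n l μ u b = l := by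
  have h1 := h.lt_mean
  have h2 := h.mean_lt
  by_cases hn : n = 2
  · subst hn
    rw [h.xTilde_two]
  · have h3 : (3 : ℝ) ≤ n := by exact_mod_cast h.three_le hn
    refine max_eq_left ((min_le_right _ _).trans ?_)
    rw [div_le_iff₀ (by linarith)]
    nlinarith

lemma xTilde_le (h : IsNondegenerate n l μ u) (hb : b ∈ Set.Icc l u) :
    xTilde n l μ u b ≤ b := by
  rcases hb.1.eq_or_lt with rfl | hlb
  · rw [h.xTilde_of_le le_rfl]
  · exact (h.xTilde_lt hlb hb.2).le

lemma lossHigh_eq : lossHigh n l μ u b =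
    (b - xTilde n l μ u b) * probLow μ u (xTilde n l μ u b) ^ (n - 1) := mul_comm _ _

lemma lossHigh_self (h : IsNondegenerate n l μ u) : lossHigh n l μ u l = 0 := by
  rw [lossHigh_eq, h.xTilde_of_le le_rfl, sub_self, zero_mul]

lemma lossHigh_nonneg (h : IsNondegenerate n l μ u) (hb : b ∈ Set.Icc l u) :
    0 ≤ lossHigh n l μ u b := by
  rw [lossHigh_eq]
  have := h.xTilde_le hb
  exact mul_nonneg (by linarith) (pow_pos (probLow_pos h.mean_lt (h.xTilde_mem b).2) _).le

lemma lossHigh_pos (h : IsNondegenerate n l μ u) (hlb : l < b) (hb : b ≤ u) :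
    0 < lossHigh n l μ u b := by
  rw [lossHigh_eq]
  have := h.xTilde_lt hlb hb
  exact mul_pos (by linarith) (pow_pos (probLow_pos h.mean_lt (h.xTilde_mem b).2) _)

/-- `xTilde` maximizes the left side over x: with the common factor (u - μ) ^ (n - 1) removed, this
is `sub_mul_pow_le` centred at `xTilde`. -/
lemma le_lossHigh (h : IsNondegenerate n l μ u) (hb : b ∈ Set.Icc l u) (hx : x ∈ Set.Icc l μ) :
    (b - x) * probLow μ u x ^ (n - 1) ≤ lossHigh n l μ u b := by
  have hμ := h.mean_lt
  have hle := h.xTilde_le hb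
  have hm := h.xTilde_mem b
  have hfo := h.xTilde_first_order hb.2 hx
  rw [lossHigh_eq]
  set y := xTilde n l μ u b
  have hyu : 0 < u - y := by linarith [hm.2]
  have hxu : 0 < u - x := by linarith [hx.2]
  have key := sub_mul_pow_le (N := n - 1) (T := b - y) (D := u - y) (s := x - y)
    (by linarith) hyu (by linarith) hfo
  rw [sub_sub_sub_cancel_right, sub_sub_sub_cancel_right] at key
  rw [probLow, probLow, div_pow, div_pow, mul_div_assoc', mul_div_assoc',
    div_le_div_iff₀ (pow_pos hxu _) (pow_pos hyu _)]
  have h0 : 0 ≤ (u - μ) ^ (n - 1) := pow_nonneg (by linarith) _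
  calc (b - x) * (u - μ) ^ (n - 1) * (u - y) ^ (n - 1)
      = (u - μ) ^ (n - 1) * ((b - x) * (u - y) ^ (n - 1)) := by ring
    _ ≤ (u - μ) ^ (n - 1) * ((b - y) * (u - x) ^ (n - 1)) := by gcongr
    _ = _ := by ring

lemma lossHigh_le_sub (h : IsNondegenerate n l μ u) (hb : b ∈ Set.Icc l u) :
    lossHigh n l μ u b ≤ (b - xTilde n l μ u b) * probLow μ u (xTilde n l μ u b) := by
  have hm := (h.xTilde_mem b).2
  have hle := h.xTilde_le hb
  rw [lossHigh_eq]
  have := pow_le_of_le_one (probLow_pos h.mean_lt hm).le (probLow_le_one h.mean_lt hm)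
    h.pred_ne_zero
  exact mul_le_mul_of_nonneg_left this (by linarith)

lemma sub_mul_probLow (hx : x < u) : (u - x) * probLow μ u x = u - μ :=
  mul_div_cancel₀ _ (by linarith)

lemma lossHigh_lt (h : IsNondegenerate n l μ u) (hlb : l ≤ b) (hb : b < u) :
    lossHigh n l μ u b < u - μ := by
  have hm := (h.xTilde_mem b).2
  refine (h.lossHigh_le_sub ⟨hlb, hb.le⟩).trans_lt ?_
  rw [← sub_mul_probLow (hm.trans_lt h.mean_lt)]
  have := probLow_pos h.mean_lt hm
  gcongr

lemma lossHigh_top (h : IsNondegenerate n l μ u) : lossHigh n l μ u u = u - μ := by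
  have hm := (h.xTilde_mem u).2
  have hu : u ∈ Set.Icc l u := ⟨(h.lt_mean.trans h.mean_lt).le, le_rfl⟩
  refine le_antisymm ((h.lossHigh_le_sub hu).trans_eq
    (sub_mul_probLow (hm.trans_lt h.mean_lt))) ?_
  have := h.le_lossHigh hu ⟨h.lt_mean.le, le_rfl⟩
  rwa [probLow_mean h.mean_lt, one_pow, mul_one] at this

lemma continuous_lossHigh (h : IsNondegenerate n l μ u) : Continuous (lossHigh n l μ u) := by
  have hc : Continuous (xTilde n l μ u) := by unfold xTilde; fun_prop
  unfold lossHigh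
  refine ((continuous_const.div (continuous_const.sub hc) fun b => ?_).pow _).mul
    (continuous_id.sub hc)
  have := (h.xTilde_mem b).2
  have := h.mean_lt
  exact (show 0 < u - xTilde n l μ u b by linarith).ne'

/-- Bernoulli's inequality bounds ((u - y) / (u - b)) ^ (n - 1) from below, y being `xTilde`. For b
≤ μ this becomes the strict first-order condition by which (v - x) `probLow μ u x ^ (n - 1)` is
decreasing at x = b when v is the value of b. -/
lemma pred_mul_lossHigh_lt (h : IsNondegenerate n l μ u) (hlb : l ≤ b) (hb : b < u) :
    (n - 1 : ℕ) * lossHigh n l μ u b < (u - b) * probLow μ u b ^ (n - 1) := by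
  have hm := h.xTilde_mem b
  have hle := h.xTilde_le ⟨hlb, hb.le⟩
  have hμ := h.mean_lt
  rw [lossHigh_eq]
  set y := xTilde n l μ u b
  have hbu : 0 < u - b := by linarith
  have hyu : 0 < u - y := by linarith
  have hB := one_add_mul_le_pow (a := (b - y) / (u - b))
    (by have := div_nonneg (show 0 ≤ b - y by linarith) hbu.le; linarith) (n - 1)
  rw [one_add_div hbu.ne', sub_add_sub_cancel, div_pow, le_div_iff₀ (pow_pos hbu _)] at hB
  have hlt : (n - 1 : ℕ) * (b - y) * (u - b) ^ (n - 1) < (u - b) * (u - y) ^ (n - 1) := by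
    have e : (u - b) * ((1 + (n - 1 : ℕ) * ((b - y) / (u - b))) * (u - b) ^ (n - 1)) =
        (u - b) * (u - b) ^ (n - 1) + (n - 1 : ℕ) * (b - y) * (u - b) ^ (n - 1) := by
      field_simp
    have h1 := mul_le_mul_of_nonneg_left hB hbu.le
    have h2 : 0 < (u - b) * (u - b) ^ (n - 1) := by positivity
    linarith
  rw [probLow, probLow, div_pow, div_pow, ← mul_assoc, mul_div_assoc', mul_div_assoc',
    div_lt_div_iff₀ (pow_pos hyu _) (pow_pos hbu _)]
  have h0 : 0 < (u - μ) ^ (n - 1) := pow_pos (by linarith) _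
  calc (n - 1 : ℕ) * (b - y) * (u - μ) ^ (n - 1) * (u - b) ^ (n - 1)
      = (u - μ) ^ (n - 1) * ((n - 1 : ℕ) * (b - y) * (u - b) ^ (n - 1)) := by ring
    _ < (u - μ) ^ (n - 1) * ((u - b) * (u - y) ^ (n - 1)) := by gcongr
    _ = _ := by ring

end LossHigh

/-! ### The inverse bidding function -/

section ValueOf

variable {n : ℕ} {l μ u : ℝ} {b : ℝ}

/-- The clamps `min b μ` and `max b μ` keep the denominators away from zero for every real b, so
continuity is global and pushing G forward is unproblematic. -/
lemma continuous_valueOf (h : IsNondegenerate n l μ u) : Continuous (valueOf n l μ u) := by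
  have h1 := h.lt_mean
  have h2 := h.mean_lt
  unfold valueOf
  have hQ : Continuous fun b => probLow μ u (min b μ) := by
    refine continuous_const.div (by fun_prop) fun b => ?_
    have := min_le_right b μ
    exact (show 0 < u - min b μ by linarith).ne'
  have hR : Continuous fun b => probBelow l μ (max b μ) := by
    refine Continuous.div (by fun_prop) (by fun_prop) fun b => ?_
    have := le_max_right b μ
    exact (show 0 < max b μ - l by linarith).ne'
  refine continuous_id.add (h.continuous_lossHigh.div ((hQ.pow _).mul
    (continuous_const.sub (hR.pow _))) fun b => ?_)
  exact (mul_pos (pow_pos (probLow_pos h2 (min_le_right b μ)) _)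
    (h.one_sub_probBelow_pow_pos (le_max_right b μ))).ne'

/-- For b ≤ μ the clamp makes the `probBelow` factor trivial; for b ≥ μ, in `valueOf_of_ge`, it does
so for the `probLow` factor. -/
lemma valueOf_of_le (h : IsNondegenerate n l μ u) (hb : b ≤ μ) :
    (valueOf n l μ u b - b) * probLow μ u b ^ (n - 1) = lossHigh n l μ u b := by
  have := (pow_pos (probLow_pos h.mean_lt hb) (n - 1)).ne'
  rw [valueOf, min_eq_left hb, max_eq_right hb, probBelow_mean, zero_pow h.pred_ne_zero]
  field_simp
  ring

lemma valueOf_of_ge (h : IsNondegenerate n l μ u) (hb : μ ≤ b) :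
    (valueOf n l μ u b - b) * (1 - probBelow l μ b ^ (n - 1)) = lossHigh n l μ u b := by
  have := (h.one_sub_probBelow_pow_pos hb).ne'
  rw [valueOf, min_eq_right hb, max_eq_left hb, probLow_mean h.mean_lt, one_pow, one_mul]
  field_simp
  ring

lemma le_valueOf (h : IsNondegenerate n l μ u) (hb : b ∈ Set.Icc l u) :
    b ≤ valueOf n l μ u b :=
  le_add_of_nonneg_right (div_nonneg (h.lossHigh_nonneg hb)
    (mul_pos (pow_pos (probLow_pos h.mean_lt (min_le_right b μ)) _)
      (h.one_sub_probBelow_pow_pos (le_max_right b μ))).le)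

lemma lt_valueOf (h : IsNondegenerate n l μ u) (hlb : l < b) (hb : b ≤ u) :
    b < valueOf n l μ u b :=
  lt_add_of_pos_right _ (div_pos (h.lossHigh_pos hlb hb)
    (mul_pos (pow_pos (probLow_pos h.mean_lt (min_le_right b μ)) _)
      (h.one_sub_probBelow_pow_pos (le_max_right b μ))))

lemma valueOf_bot (h : IsNondegenerate n l μ u) : valueOf n l μ u l = l := by
  rw [valueOf, h.lossHigh_self, zero_div, add_zero]

end ValueOf

/-! ### Worst-case opponents: lower bounds on the maximal loss -/

section LowerBounds

variable {n : ℕ} {l μ u : ℝ} {i : Fin n} {v b x : ℝ}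

lemma probLow_mean_eq (hx : x < u) :
    probLow μ u x * x + (1 - probLow μ u x) * u = μ := by
  have := sub_mul_probLow (μ := μ) hx
  linarith

/-- Opponents bid x or u, with x as likely as the mean allows. Both b and c slightly above x win
exactly when all bid x; letting c fall to x gives the overpayment b - x. -/
lemma sub_mul_probLow_le_maxLoss (h : IsNondegenerate n l μ u) (hx : x ∈ Set.Icc l μ)
    (hxb : x < b) (hbu : b < u) :
    (b - x) * probLow μ u x ^ (n - 1) ≤ maxLoss i l μ u v b := by
  have hμ := h.mean_lt
  have hl := h.nonneg
  have hxu : x < u := hxb.trans hbu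
  have ht : Filter.Tendsto (fun c => (b - c) * probLow μ u x ^ (n - 1)) (nhdsWithin x (Set.Ioi x))
      (nhds ((b - x) * probLow μ u x ^ (n - 1))) :=
    ((continuous_const.sub continuous_id).mul continuous_const).continuousWithinAt
  refine le_of_tendsto ht ?_
  filter_upwards [Ioo_mem_nhdsGT hxu] with c hc
  have := twoPoint_le_maxLoss (i := i) (v := v) (b := b) (b' := c)
    (probLow_pos hμ hx.2).le (probLow_le_one hμ hx.2) hl
    ⟨hx.1, hxu.le⟩ ⟨hx.1.trans hxu.le, le_rfl⟩ (probLow_mean_eq hxu)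
    (by linarith [hx.1, hc.1]) hxb.ne' hbu.ne hc.1.ne' hc.2.ne
  rw [if_pos hc.1, if_pos hxb, if_neg hc.2.not_gt, if_neg hbu.not_gt, add_zero] at this
  linarith

/-- The same opponents, but now b lies below x and never wins. -/
lemma sub_mul_probLow_le_maxLoss_of_lt (h : IsNondegenerate n l μ u) (hx : x ∈ Set.Icc l μ)
    (hbx : b < x) : (v - x) * probLow μ u x ^ (n - 1) ≤ maxLoss i l μ u v b := by
  have hμ := h.mean_lt
  have hl := h.nonneg
  have hxu : x < u := hx.2.trans_lt hμ
  have ht : Filter.Tendsto (fun c => (v - c) * probLow μ u x ^ (n - 1)) (nhdsWithin x (Set.Ioi x))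
      (nhds ((v - x) * probLow μ u x ^ (n - 1))) :=
    ((continuous_const.sub continuous_id).mul continuous_const).continuousWithinAt
  refine le_of_tendsto ht ?_
  filter_upwards [Ioo_mem_nhdsGT hxu] with c hc
  have := twoPoint_le_maxLoss (i := i) (v := v) (b := b) (b' := c)
    (probLow_pos hμ hx.2).le (probLow_le_one hμ hx.2) hl
    ⟨hx.1, hxu.le⟩ ⟨hx.1.trans hxu.le, le_rfl⟩ (probLow_mean_eq hxu)
    (by linarith [hx.1, hc.1]) hbx.ne (hbx.trans hxu).ne hc.1.ne' hc.2.ne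
  rw [if_pos hc.1, if_neg hbx.not_gt, if_neg hc.2.not_gt, if_neg (hbx.trans hxu).not_gt,
    add_zero, add_zero, zero_pow h.pred_ne_zero] at this
  linarith

/-- Opponents bid l or z with z slightly above b: b wins only if all bid l, while a bid just above z
always wins. Then z falls to b. -/
lemma sub_mul_one_sub_probBelow_le_maxLoss (h : IsNondegenerate n l μ u) (hμb : μ ≤ b)
    (hbu : b < u) : (v - b) * (1 - probBelow l μ b ^ (n - 1)) ≤ maxLoss i l μ u v b := by
  have hlμ := h.lt_mean
  have hl := h.nonneg
  have hc : ContinuousAt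
      -- The rival bid z + (z - b) stays off the atom z and tends to b together with z.
      (fun z => (v - (z + (z - b))) - (v - b) * probBelow l μ z ^ (n - 1)) b := by
    have : ContinuousAt (probBelow l μ) b := by
      unfold probBelow
      exact ContinuousAt.div (by fun_prop) (by fun_prop) (show 0 < b - l by linarith).ne'
    fun_prop
  have ht := hc.continuousWithinAt (s := Set.Ioi b)
  have e : (v - b) * (1 - probBelow l μ b ^ (n - 1)) =
      (v - (b + (b - b))) - (v - b) * probBelow l μ b ^ (n - 1) := by ring
  rw [e]
  refine le_of_tendsto ht ?_
  filter_upwards [Ioo_mem_nhdsGT hbu] with z hz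
  obtain ⟨hz1, hz2⟩ := hz
  have hlz : l < z := by linarith
  have := twoPoint_le_maxLoss (i := i) (v := v) (b := b) (b' := z + (z - b)) (x := l) (y := z)
    (l := l) (u := u) (μ := μ)
    (probBelow_nonneg hlμ (hμb.trans hz1.le)) (probBelow_lt_one hlμ (hμb.trans hz1.le)).le hl
    ⟨le_rfl, by linarith⟩ ⟨hlz.le, hz2.le⟩
    (by
      have : z - l ≠ 0 := by linarith
      rw [probBelow]
      field_simp
      ring)
    (by linarith) (by linarith) (by linarith) (by linarith) (by linarith)
  rw [if_pos (by linarith), if_pos (by linarith), if_pos (by linarith), if_neg (by linarith),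
    add_sub_cancel, one_pow, mul_one, add_zero] at this
  exact this

/-- All opponents bid μ for sure. This also covers b ≥ u, where the law with an atom at u gives no
such bound. -/
lemma sub_mean_le_maxLoss (h : IsNondegenerate n l μ u) (hb : μ < b) :
    b - μ ≤ maxLoss i l μ u v b := by
  have hl := h.nonneg
  have hlμ := h.lt_mean
  have hμ := h.mean_lt
  have ht : Filter.Tendsto (fun c => b - c) (nhdsWithin μ (Set.Ioi μ)) (nhds (b - μ)) :=
    (continuous_const.sub continuous_id).continuousWithinAt
  refine le_of_tendsto ht ?_
  filter_upwards [self_mem_nhdsWithin] with c hc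
  have hc : μ < c := hc
  have := twoPoint_le_maxLoss (i := i) (v := v) (b := b) (b' := c) (μ := μ) (p := 1)
    zero_le_one le_rfl hl ⟨hlμ.le, hμ.le⟩ ⟨hlμ.le, hμ.le⟩ (by ring)
    (by linarith) hb.ne' hb.ne' hc.ne' hc.ne'
  rw [if_pos hc, if_pos hc, if_pos hb, if_pos hb, add_sub_cancel, one_pow] at this
  linarith

end LowerBounds

/-! ### Upper bounds on the gain from deviating -/

section UpperBounds

variable {n : ℕ} {l μ u : ℝ} {i : Fin n} {v b b' m : ℝ} {B : {j : Fin n // j ≠ i} → Measure ℝ}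

lemma prod_real_Iic_le (hB : B ∈ jointBeliefSet i l μ u) (hb : b < u) :
    ∏ j, (B j).real (Set.Iic b) ≤ probLow μ u b ^ (n - 1) := by
  refine (Finset.prod_le_prod (fun _ _ => measureReal_nonneg)
    fun j _ => real_Iic_le (hB j) hb).trans_eq ?_
  simp [probLow, div_pow]

lemma le_prod_real_Iio (h : IsNondegenerate n l μ u) (hB : B ∈ jointBeliefSet i l μ u)
    (hb : μ ≤ b) : probBelow l μ b ^ (n - 1) ≤ ∏ j, (B j).real (Set.Iio b) := by
  refine Eq.trans_le ?_ (Finset.prod_le_prod (fun _ _ => probBelow_nonneg h.lt_mean hb)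
    fun j _ => le_real_Iio (hB j) (h.lt_mean.trans_le hb))
  simp

lemma prod_real_le_one (hB : B ∈ jointBeliefSet i l μ u) (s : Set ℝ) :
    ∏ j, (B j).real s ≤ 1 := by
  have : ∀ j, IsProbabilityMeasure (B j) := fun j => (hB j).1
  exact Finset.prod_le_one (fun _ _ => measureReal_nonneg) fun _ _ => measureReal_le_one

lemma prod_real_Iic_eq_zero (h : IsNondegenerate n l μ u) (hB : B ∈ jointBeliefSet i l μ u)
    (hb : b < l) : ∏ j, (B j).real (Set.Iic b) = 0 := by
  have hn := h.two_le
  have : Nonempty {j : Fin n // j ≠ i} := by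
    rw [← Fintype.card_pos_iff]
    simp
    omega
  exact Finset.prod_eq_zero (Finset.mem_univ (Classical.arbitrary _))
    (real_Iic_eq_zero (hB _) hb)

/-- Whenever b' wins or ties, b wins outright, so the gain is at most b - b' times the probability
that all opponents bid at most b'. The bound m is left free because the lemma serves both `lossHigh`
and bids above u. -/
lemma expUtility_sub_le_of_lt (h : IsNondegenerate n l μ u) (hB : B ∈ jointBeliefSet i l μ u)
    (hm0 : 0 ≤ m) (hm : ∀ x ∈ Set.Icc l μ, (b - x) * probLow μ u x ^ (n - 1) ≤ m)
    (hbv : b ≤ v) (hb : b' < b) : expUtility i v b' B - expUtility i v b B ≤ m := by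
  have : ∀ j, IsProbabilityMeasure (B j) := fun j => (hB j).1
  have h1 := expUtility_le (B := B) (hb.le.trans hbv)
  have h2 := le_expUtility (B := B) hbv
  have hmono : ∏ j, (B j).real (Set.Iic b') ≤ ∏ j, (B j).real (Set.Iio b) :=
    Finset.prod_le_prod (fun _ _ => measureReal_nonneg)
      fun j _ => measureReal_mono (Set.Iic_subset_Iio.2 hb)
  have h3 : (v - b) * ∏ j, (B j).real (Set.Iic b') ≤ (v - b) * ∏ j, (B j).real (Set.Iio b) :=
    mul_le_mul_of_nonneg_left hmono (by linarith)
  have h4 : expUtility i v b' B - expUtility i v b B ≤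
      (b - b') * ∏ j, (B j).real (Set.Iic b') := by linarith
  refine h4.trans ?_
  rcases lt_or_ge b' l with hl | hl
  · rw [prod_real_Iic_eq_zero h hB hl, mul_zero]
    exact hm0
  rcases le_or_gt b' μ with hμ | hμ
  · refine le_trans ?_ (hm b' ⟨hl, hμ⟩)
    exact mul_le_mul_of_nonneg_left (prod_real_Iic_le hB (hμ.trans_lt h.mean_lt)) (by linarith)
  · have h5 := hm μ ⟨h.lt_mean.le, le_rfl⟩
    rw [probLow_mean h.mean_lt, one_pow, mul_one] at h5
    have h6 := mul_le_mul_of_nonneg_left (prod_real_le_one hB (Set.Iic b'))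
      (show 0 ≤ b - b' by linarith)
    linarith

lemma expUtility_sub_le_of_gt_of_le_mean (h : IsNondegenerate n l μ u)
    (hB : B ∈ jointBeliefSet i l μ u) (hbv : b ≤ v) (hbμ : b ≤ μ)
    (hv : (n - 1 : ℕ) * (v - b) ≤ u - b) (hb : b < b') :
    expUtility i v b' B - expUtility i v b B ≤ (v - b) * probLow μ u b ^ (n - 1) := by
  have : ∀ j, IsProbabilityMeasure (B j) := fun j => (hB j).1
  have hμ := h.mean_lt
  have h2 : 0 ≤ expUtility i v b B := expUtility_nonneg hbv
  have hpos : 0 ≤ (v - b) * probLow μ u b ^ (n - 1) :=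
    mul_nonneg (by linarith) (pow_pos (probLow_pos hμ hbμ) _).le
  rcases le_total v b' with hvb | hvb
  · have := expUtility_nonpos (i := i) (B := B) hvb
    linarith
  have h1 := expUtility_le (B := B) hvb
  -- `hv` is the first-order condition at b, made global by `sub_mul_pow_le`: the best upward
  -- deviation is the one just above b.
  have key : ∀ x, b ≤ x → x ≤ μ →
      (v - x) * probLow μ u x ^ (n - 1) ≤ (v - b) * probLow μ u b ^ (n - 1) := by
    intro x hbx hxμ
    have hbu : 0 < u - b := by linarith
    have hxu : 0 < u - x := by linarith
    have hk := sub_mul_pow_le (N := n - 1) (T := v - b) (D := u - b) (s := x - b)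
      (by linarith) hbu (by linarith) (mul_nonneg (by linarith) (by linarith))
    rw [sub_sub_sub_cancel_right, sub_sub_sub_cancel_right] at hk
    rw [probLow, probLow, div_pow, div_pow, mul_div_assoc', mul_div_assoc',
      div_le_div_iff₀ (pow_pos hxu _) (pow_pos hbu _)]
    have h0 : 0 ≤ (u - μ) ^ (n - 1) := pow_nonneg (by linarith) _
    calc (v - x) * (u - μ) ^ (n - 1) * (u - b) ^ (n - 1)
        = (u - μ) ^ (n - 1) * ((v - x) * (u - b) ^ (n - 1)) := by ring
      _ ≤ (u - μ) ^ (n - 1) * ((v - b) * (u - x) ^ (n - 1)) := by gcongr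
      _ = _ := by ring
  rcases le_total b' μ with hb'μ | hb'μ
  · have := mul_le_mul_of_nonneg_left (prod_real_Iic_le hB (hb'μ.trans_lt hμ))
      (show 0 ≤ v - b' by linarith)
    have := key b' hb.le hb'μ
    linarith
  · have h3 := key μ hbμ le_rfl
    rw [probLow_mean hμ, one_pow, mul_one] at h3
    have h4 := mul_le_mul_of_nonneg_left (prod_real_le_one hB (Set.Iic b'))
      (show 0 ≤ v - b' by linarith)
    linarith

lemma expUtility_sub_le_of_gt_of_mean_le (h : IsNondegenerate n l μ u)
    (hB : B ∈ jointBeliefSet i l μ u) (hbv : b ≤ v) (hbμ : μ ≤ b) (hb : b < b') :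
    expUtility i v b' B - expUtility i v b B ≤ (v - b) * (1 - probBelow l μ b ^ (n - 1)) := by
  have : ∀ j, IsProbabilityMeasure (B j) := fun j => (hB j).1
  have hpos : 0 ≤ (v - b) * (1 - probBelow l μ b ^ (n - 1)) :=
    mul_nonneg (by linarith) (h.one_sub_probBelow_pow_pos hbμ).le
  rcases le_total v b' with hvb | hvb
  · have := expUtility_nonpos (i := i) (B := B) hvb
    have : 0 ≤ expUtility i v b B := expUtility_nonneg hbv
    linarith
  have h1 := expUtility_le (B := B) hvb
  have h2 := le_expUtility (B := B) hbv
  have h3 := mul_le_mul_of_nonneg_left (prod_real_le_one hB (Set.Iic b'))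
    (show 0 ≤ v - b' by linarith)
  have h4 := mul_le_mul_of_nonneg_left (le_prod_real_Iio h hB hbμ) (show 0 ≤ v - b by linarith)
  linarith

lemma expUtility_of_top_lt (hB : B ∈ jointBeliefSet i l μ u) (hb : u < b) :
    expUtility i v b B = v - b := by
  have : ∀ j, IsProbabilityMeasure (B j) := fun j => (hB j).1
  have h1 : ∀ j, B j (Set.Iio b) = 1 := fun j =>
    le_antisymm prob_le_one ((hB j).2.2.1 ▸ measure_mono fun x hx => hx.2.trans_lt hb)
  have h2 : ∀ j, B j {b} = 0 := fun j =>
    measure_mono_null (t := (Set.Icc l u)ᶜ)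
      (by rintro x rfl hx; exact hb.not_ge hx.2)
      ((prob_compl_eq_zero_iff measurableSet_Icc).2 (hB j).2.2.1)
  rw [expUtility_eq h2]
  simp [measureReal_def, h1]

end UpperBounds

/-! ### Minimax bids and strict monotonicity of `valueOf` -/

section Minimax

variable {n : ℕ} {l μ u : ℝ} {i : Fin n} {v b c : ℝ}

lemma nonempty (h : IsNondegenerate n l μ u) (i : Fin n) : (jointBeliefSet i l μ u).Nonempty :=
  jointBeliefSet_nonempty h.nonneg h.lt_mean.le h.mean_lt.le

lemma pred_mul_valueOf_sub_lt (h : IsNondegenerate n l μ u) (hlb : l ≤ b) (hb : b ≤ μ) :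
    (n - 1 : ℕ) * (valueOf n l μ u b - b) < u - b := by
  have h1 := h.pred_mul_lossHigh_lt hlb (hb.trans_lt h.mean_lt)
  rw [← h.valueOf_of_le hb, ← mul_assoc] at h1
  exact lt_of_mul_lt_mul_right h1 (pow_pos (probLow_pos h.mean_lt hb) _).le

lemma maxLoss_valueOf_le (h : IsNondegenerate n l μ u) (i : Fin n) (hb : b ∈ Set.Icc l u) :
    maxLoss i l μ u (valueOf n l μ u b) b ≤ lossHigh n l μ u b := by
  refine maxLoss_le (h.nonempty i) fun B hB b' _ => ?_
  have hbv := h.le_valueOf hb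
  rcases lt_trichotomy b' b with hlt | rfl | hgt
  · exact expUtility_sub_le_of_lt h hB (h.lossHigh_nonneg hb) (fun x hx => h.le_lossHigh hb hx)
      hbv hlt
  · rw [sub_self]
    exact h.lossHigh_nonneg hb
  · rcases le_total b μ with hμ | hμ
    · rw [← h.valueOf_of_le hμ]
      exact expUtility_sub_le_of_gt_of_le_mean h hB hbv hμ
        (h.pred_mul_valueOf_sub_lt hb.1 hμ).le hgt
    · rw [← h.valueOf_of_ge hμ]
      exact expUtility_sub_le_of_gt_of_mean_le h hB hbv hμ hgt

/-- Keep the opponents that are worst for b: raising the bid to c < u only increases the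
overpayment. For c ≥ u, constant opponents at μ suffice. -/
lemma lossHigh_lt_maxLoss_of_gt (h : IsNondegenerate n l μ u) (hb : b ∈ Set.Icc l u)
    (hc : b < c) : lossHigh n l μ u b < maxLoss i l μ u v c := by
  rcases lt_or_ge c u with hcu | hcu
  · have hm := h.xTilde_mem b
    have hle := h.xTilde_le hb
    refine lt_of_lt_of_le ?_ (h.sub_mul_probLow_le_maxLoss hm (hle.trans_lt hc) hcu)
    rw [lossHigh_eq]
    have := pow_pos (probLow_pos h.mean_lt hm.2) (n - 1)
    gcongr
  · refine lt_of_lt_of_le ?_ (h.sub_mean_le_maxLoss (h.mean_lt.trans_le hcu))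
    rcases hb.2.lt_or_eq with hbu | rfl
    · linarith [h.lossHigh_lt hb.1 hbu]
    · rw [h.lossHigh_top]
      linarith

lemma lossHigh_lt_maxLoss_of_lt (h : IsNondegenerate n l μ u) (hlb : l < b) (hb : b ≤ u)
    (hc : c < b) : lossHigh n l μ u b < maxLoss i l μ u (valueOf n l μ u b) c := by
  have hμ := h.mean_lt
  have hlμ := h.lt_mean
  have hbv := h.lt_valueOf hlb hb
  rcases le_or_gt b μ with hbμ | hbμ
  · have hk := h.pred_mul_valueOf_sub_lt hlb.le hbμ
    rw [← h.valueOf_of_le hbμ]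
    set v := valueOf n l μ u b
    -- The first-order condition is strict at b and so persists slightly to the left; an atom x
    -- strictly between c and b then causes strictly more loss than one at b.
    have hev : ∀ᶠ x in nhdsWithin b (Set.Iio b), (n - 1 : ℕ) * (v - x) < u - x := by
      have h1 : Continuous fun x : ℝ => ((n - 1 : ℕ) : ℝ) * (v - x) := by fun_prop
      have h2 : Continuous fun x : ℝ => u - x := by fun_prop
      exact ((h1.tendsto b).eventually_lt (h2.tendsto b) hk).filter_mono nhdsWithin_le_nhds
    obtain ⟨x, hx, hx1, hx2⟩ := (hev.and (Ioo_mem_nhdsLT (max_lt hc hlb))).exists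
    have hcx := (le_max_left _ _).trans_lt hx1
    have hlx := (le_max_right _ _).trans_lt hx1
    refine lt_of_lt_of_le ?_
      (h.sub_mul_probLow_le_maxLoss_of_lt ⟨hlx.le, hx2.le.trans hbμ⟩ hcx)
    have hbu : 0 < u - b := by linarith
    have hxu : 0 < u - x := by linarith
    have hk := sub_mul_pow_lt (N := n - 1) (T := v - x) (D := u - x) (s := b - x)
      (by linarith) hxu (by linarith) (mul_pos (by linarith) (by linarith))
    rw [sub_sub_sub_cancel_right, sub_sub_sub_cancel_right] at hk
    rw [probLow, probLow, div_pow, div_pow, mul_div_assoc', mul_div_assoc',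
      div_lt_div_iff₀ (pow_pos hbu _) (pow_pos hxu _)]
    have h0 : 0 < (u - μ) ^ (n - 1) := pow_pos (by linarith) _
    calc (v - b) * (u - μ) ^ (n - 1) * (u - x) ^ (n - 1)
        = (u - μ) ^ (n - 1) * ((v - b) * (u - x) ^ (n - 1)) := by ring
      _ < (u - μ) ^ (n - 1) * ((v - x) * (u - b) ^ (n - 1)) := by gcongr
      _ = _ := by ring
  · have hR := h.one_sub_probBelow_pow_pos hbμ.le
    rw [← h.valueOf_of_ge hbμ.le]
    set v := valueOf n l μ u b
    rcases lt_or_ge c μ with hcμ | hcμ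
    · refine lt_of_lt_of_le ?_ (h.sub_mul_probLow_le_maxLoss_of_lt ⟨hlμ.le, le_rfl⟩ hcμ)
      rw [probLow_mean hμ, one_pow, mul_one]
      have h1 : 1 - probBelow l μ b ^ (n - 1) ≤ 1 :=
        sub_le_self _ (pow_nonneg (probBelow_nonneg hlμ hbμ.le) _)
      have := mul_le_of_le_one_right (show 0 ≤ v - b by linarith) h1
      linarith
    · refine lt_of_lt_of_le ?_ (h.sub_mul_one_sub_probBelow_le_maxLoss hcμ (hc.trans_le hb))
      have := h.one_sub_probBelow_pow_lt hcμ hc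
      exact mul_lt_mul (by linarith) this.le hR (by linarith)

/-- The excluded case b = l, c < l is a real exception: the value is then l, and neither bid has any
loss. -/
lemma lossHigh_lt_maxLoss (h : IsNondegenerate n l μ u) (hb : b ∈ Set.Icc l u)
    (hbc : l < b ∨ l ≤ c) (hc : c ≠ b) :
    lossHigh n l μ u b < maxLoss i l μ u (valueOf n l μ u b) c := by
  rcases lt_or_gt_of_ne hc with hlt | hgt
  · exact h.lossHigh_lt_maxLoss_of_lt (hbc.elim id fun h' => h'.trans_lt hlt) hb.2 hlt
  · exact h.lossHigh_lt_maxLoss_of_gt hb hgt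

lemma isMinimaxBid_valueOf (h : IsNondegenerate n l μ u) (i : Fin n) (hb : b ∈ Set.Icc l u) :
    IsMinimaxBid i l μ u (valueOf n l μ u b) b := by
  refine ⟨h.nonneg.trans hb.1, fun c hc => ?_⟩
  rcases eq_or_ne c b with rfl | hne
  · exact le_rfl
  by_cases hbc : l < b ∨ l ≤ c
  · exact (h.maxLoss_valueOf_le i hb).trans (h.lossHigh_lt_maxLoss hb hbc hne).le
  · push Not at hbc
    obtain rfl : b = l := le_antisymm hbc.1 hb.1
    refine (h.maxLoss_valueOf_le i hb).trans ?_
    obtain ⟨B, hB⟩ := h.nonempty i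
    -- A maximal loss is never negative: compare the bid c with itself.
    rw [h.lossHigh_self]
    simpa using sub_le_maxLoss (v := valueOf n b μ u b) (b := c) hB hc

lemma eq_of_isMinimaxBid_valueOf (h : IsNondegenerate n l μ u) (hb : b ∈ Set.Icc l u)
    (hbc : l < b ∨ l ≤ c) (hc : IsMinimaxBid i l μ u (valueOf n l μ u b) c) : c = b := by
  by_contra hne
  exact absurd (hc.2 b (h.nonneg.trans hb.1)) (not_le.2
    ((h.maxLoss_valueOf_le i hb).trans_lt (h.lossHigh_lt_maxLoss hb hbc hne)))

/-- Two bids with the same value are both minimax for it, and a minimax bid of at least l is unique.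
-/
lemma injOn_valueOf (h : IsNondegenerate n l μ u) :
    Set.InjOn (valueOf n l μ u) (Set.Icc l u) := by
  intro b hb c hc hbc
  have hn := h.two_le
  have := h.isMinimaxBid_valueOf ⟨0, by omega⟩ hb
  rw [hbc] at this
  exact h.eq_of_isMinimaxBid_valueOf hc (Or.inr hb.1) this

lemma lt_top (h : IsNondegenerate n l μ u) : l < u := h.lt_mean.trans h.mean_lt

lemma strictMonoOn_valueOf (h : IsNondegenerate n l μ u) :
    StrictMonoOn (valueOf n l μ u) (Set.Icc l u) := by
  refine h.continuous_valueOf.continuousOn.strictMonoOn_of_injOn_Icc h.lt_top.le ?_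
    h.injOn_valueOf
  rw [h.valueOf_bot]
  exact (h.lt_top.trans (h.lt_valueOf h.lt_top le_rfl)).le

lemma exists_valueOf_eq (h : IsNondegenerate n l μ u)
    (hv : v ∈ Set.Icc l (valueOf n l μ u u)) : ∃ b ∈ Set.Icc l u, valueOf n l μ u b = v := by
  have := intermediate_value_Icc h.lt_top.le h.continuous_valueOf.continuousOn
  rw [h.valueOf_bot] at this
  exact this hv

/-- With a value of at most `l`, no minimax bid is above `l`. -/
lemma le_of_isMinimaxBid (h : IsNondegenerate n l μ u) (hv : 0 ≤ v) (hvl : v ≤ l)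
    (hb : IsMinimaxBid i l μ u v b) : b ≤ l := by
  by_contra! hlb
  have hl : l ∈ Set.Icc l u := ⟨le_rfl, h.lt_top.le⟩
  have h1 := h.lossHigh_lt_maxLoss_of_gt (i := i) (v := v) hl hlb
  rw [h.lossHigh_self] at h1
  -- Bidding the value itself has no loss: lower bids are below l and never win, higher ones cannot
  -- profit.
  refine absurd (hb.2 v hv) (not_le.2 (lt_of_le_of_lt ?_ h1))
  refine maxLoss_le (h.nonempty i) fun B hB b' _ => ?_
  have : ∀ j, IsProbabilityMeasure (B j) := fun j => (hB j).1
  have h0 : 0 ≤ expUtility i v v B := expUtility_nonneg le_rfl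
  rcases lt_or_ge b' v with hbv | hbv
  · have := expUtility_le (B := B) hbv.le
    rw [prod_real_Iic_eq_zero h hB (hbv.trans_le hvl), mul_zero] at this
    linarith
  · have := expUtility_nonpos (i := i) (B := B) hbv
    linarith

lemma maxLoss_le_sub_mean (h : IsNondegenerate n l μ u) (hc : u < c) (hcv : c ≤ v) :
    maxLoss i l μ u v c ≤ c - μ := by
  have hμ := h.mean_lt
  refine maxLoss_le (h.nonempty i) fun B hB b' _ => ?_
  rcases lt_trichotomy b' c with hlt | rfl | hgt
  · refine expUtility_sub_le_of_lt h hB (by linarith) (fun x hx => ?_) hcv hlt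
    have hx' : x < u := hx.2.trans_lt hμ
    have h1 := pow_le_of_le_one (probLow_pos hμ hx.2).le (probLow_le_one hμ hx.2)
      h.pred_ne_zero
    have h2 : (c - x) * probLow μ u x ^ (n - 1) ≤ (c - x) * probLow μ u x :=
      mul_le_mul_of_nonneg_left h1 (by linarith)
    have h3 := sub_mul_probLow (μ := μ) hx'
    have h4 : (c - u) * probLow μ u x ≤ c - u :=
      mul_le_of_le_one_right (by linarith) (probLow_le_one hμ hx.2)
    linarith
  · linarith
  · rw [expUtility_of_top_lt hB hc, expUtility_of_top_lt hB (hc.trans hgt)]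
    linarith

/-- Above the value that bids `u`, only `u` can be a minimax bid. -/
lemma eq_top_of_isMinimaxBid (h : IsNondegenerate n l μ u) (hv : valueOf n l μ u u < v)
    (hb : IsMinimaxBid i l μ u v b) : b = u := by
  have hμ := h.mean_lt
  have hl := h.nonneg
  have hlμ := h.lt_mean
  have huv : u < v := (h.lt_valueOf h.lt_top le_rfl).trans hv
  -- Bids c slightly above u have maximal loss at most c - μ, hence arbitrarily close to u - μ. The
  -- bid u is approached from above because it may tie, and it need not be minimax itself.
  suffices hlt : b ≠ u → u - μ < maxLoss i l μ u v b by
    by_contra hne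
    obtain ⟨c, hc1, hc2⟩ := exists_between (lt_min huv (sub_lt_iff_lt_add.1 (hlt hne)))
    have h1 := hb.2 c (by linarith)
    have h2 := h.maxLoss_le_sub_mean (i := i) hc1 (hc2.le.trans (min_le_left _ _))
    have h3 := hc2.trans_le (min_le_right _ _)
    linarith
  intro hne
  rcases lt_or_gt_of_ne hne with hbu | hbu
  · rcases lt_or_ge b μ with hbμ | hbμ
    · refine lt_of_lt_of_le ?_ (h.sub_mul_probLow_le_maxLoss_of_lt ⟨hlμ.le, le_rfl⟩ hbμ)
      rw [probLow_mean hμ, one_pow, mul_one]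
      linarith
    · refine lt_of_lt_of_le ?_ (h.sub_mul_one_sub_probBelow_le_maxLoss hbμ hbu)
      rw [← h.lossHigh_top, ← h.valueOf_of_ge hμ.le]
      exact mul_lt_mul (by linarith) (h.one_sub_probBelow_pow_lt hbμ hbu).le
        (h.one_sub_probBelow_pow_pos hμ.le) (by linarith)
  · have := h.sub_mean_le_maxLoss (i := i) (v := v) (hμ.trans hbu)
    linarith

end Minimax

end IsNondegenerate

/-! ### `betaIND` inverts `valueOf` -/

namespace IsNondegenerate

variable {n : ℕ} {l μ u b v : ℝ}

lemma cutoff_eq (h : IsNondegenerate n l μ u) : cutoff n l μ u = valueOf n l μ u μ := by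
  have := h.valueOf_of_le le_rfl
  rw [probLow_mean h.mean_lt, one_pow, mul_one, lossHigh] at this
  rw [cutoff]
  linarith

lemma valueOf_two_of_le (h : IsNondegenerate 2 l μ u) (hb : b ≤ μ) :
    (valueOf 2 l μ u b - b) * (u - l) = (u - b) * (b - l) := by
  have h1 := h.lt_mean
  have h2 := h.mean_lt
  have := h.valueOf_of_le hb
  rw [lossHigh, h.xTilde_two, probLow] at this
  have hb' : u - b ≠ 0 := by linarith
  have hl' : u - l ≠ 0 := by linarith
  norm_num at this
  field_simp at this
  have h3 : u - μ ≠ 0 := by linarith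
  exact mul_left_cancel₀ h3 (by linear_combination this)

lemma valueOf_two_of_ge (h : IsNondegenerate 2 l μ u) (hb : μ ≤ b) :
    (valueOf 2 l μ u b - b) * ((μ - l) * (u - l)) = (u - μ) * (b - l) ^ 2 := by
  have h1 := h.lt_mean
  have h2 := h.mean_lt
  have := h.valueOf_of_ge hb
  rw [lossHigh, h.xTilde_two, probBelow] at this
  have hb' : b - l ≠ 0 := by linarith
  have hl' : u - l ≠ 0 := by linarith
  norm_num at this
  field_simp at this
  linear_combination this

lemma betaTwo_valueOf (h : IsNondegenerate 2 l μ u) (hb : b ∈ Set.Icc l u) :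
    betaTwo l μ u (valueOf 2 l μ u b) = b := by
  have h1 := h.lt_mean
  have h2 := h.mean_lt
  have hul : 0 < u - l := by linarith
  have hmono := h.strictMonoOn_valueOf
  have e1 : vHat₁ l μ u = valueOf 2 l μ u μ := by
    have := h.valueOf_two_of_le le_rfl
    rw [vHat₁, div_eq_iff hul.ne']
    linear_combination -this
  have e2 : vHat₂ l μ u = valueOf 2 l μ u u := by
    have := h.valueOf_two_of_ge h2.le
    rw [vHat₂, div_eq_iff (by linarith)]
    exact mul_left_cancel₀ hul.ne' (by linear_combination -this)
  have hμ : μ ∈ Set.Icc l u := ⟨h1.le, h2.le⟩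
  have hu : u ∈ Set.Icc l u := ⟨hul.le |> sub_nonneg.1, le_rfl⟩
  simp only [betaTwo, e1, e2, hmono.lt_iff_lt hb hμ, hmono.lt_iff_lt hb hu]
  split_ifs with hbμ hbu
  · have hv := h.valueOf_two_of_le hbμ.le
    -- For two bidders the value is quadratic in the bid on each piece, so the radicand is a perfect
    -- square and the sign of its root is known.
    have : (u - l) * (u - valueOf 2 l μ u b) = (u - b) ^ 2 := by linear_combination -hv
    rw [this, Real.sqrt_sq (by linarith)]
    ring
  · have hv := h.valueOf_two_of_ge (not_lt.1 hbμ)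
    have : (μ - l) * (u - l) *
        ((4 * valueOf 2 l μ u b - 3 * l) * (u - μ) + u * (μ - l) - l * (u - l)) =
        (2 * (u - μ) * (b - l) + (μ - l) * (u - l)) ^ 2 := by
      linear_combination 4 * (u - μ) * hv
    have hpos : 0 ≤ 2 * (u - μ) * (b - l) + (μ - l) * (u - l) :=
      add_nonneg (mul_nonneg (by linarith) (by linarith [hb.1]))
        (mul_nonneg (by linarith) (by linarith))
    rw [this, Real.sqrt_sq hpos]
    have : u - μ ≠ 0 := by linarith
    field_simp
    ring
  · exact le_antisymm (not_lt.1 hbu) hb.2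

lemma lossHigh_of_top_le (h : IsNondegenerate n l μ u) (hn : n ≠ 2) (hb : u ≤ b) :
    lossHigh n l μ u b = b - μ := by
  have hμ := h.mean_lt
  have h3 : (3 : ℝ) ≤ n := by exact_mod_cast h.three_le hn
  have hx : xTilde n l μ u b = μ := by
    rw [xTilde, min_eq_left, max_eq_right h.lt_mean.le]
    rw [le_div_iff₀ (by linarith)]
    nlinarith
  rw [lossHigh_eq, hx, probLow_mean hμ, one_pow, mul_one]

lemma bidEquation_valueOf (h : IsNondegenerate n l μ u) (hb : b ∈ Set.Icc l u) :
    BidEquation n l μ u (valueOf n l μ u b) b := by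
  simp only [BidEquation, h.cutoff_eq,
    h.strictMonoOn_valueOf.le_iff_le hb ⟨h.lt_mean.le, h.mean_lt.le⟩]
  split_ifs with hbμ
  · exact ⟨⟨hb.1, hbμ⟩, by rw [← h.valueOf_of_le hbμ, probLow, mul_comm]⟩
  · have hbμ := (not_le.1 hbμ).le
    exact ⟨hbμ, by rw [← h.valueOf_of_ge hbμ, probBelow]⟩

/-- Since every solution gives b after capping, the arbitrary choice made by `Classical.epsilon` is
harmless. -/
lemma min_eq_of_bidEquation (h : IsNondegenerate n l μ u) (hn : n ≠ 2) (hb : b ∈ Set.Icc l u)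
    {c : ℝ} (hc : BidEquation n l μ u (valueOf n l μ u b) c) : min c u = b := by
  have hlμ := h.lt_mean
  have hμ := h.mean_lt
  have hu : u ∈ Set.Icc l u := ⟨h.lt_top.le, le_rfl⟩
  simp only [BidEquation, h.cutoff_eq,
    h.strictMonoOn_valueOf.le_iff_le hb ⟨hlμ.le, hμ.le⟩] at hc
  split_ifs at hc with hbμ
  · obtain ⟨⟨hc1, hc2⟩, hc3⟩ := hc
    rw [← h.valueOf_of_le hc2, mul_comm, probLow] at hc3
    have := mul_left_cancel₀ (pow_pos (probLow_pos hμ hc2) (n - 1)).ne' hc3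
    have : c = b := h.injOn_valueOf ⟨hc1, hc2.trans hμ.le⟩ hb (by linarith)
    rw [this, min_eq_left hb.2]
  · obtain ⟨hc1, hc2⟩ := hc
    have hR := h.one_sub_probBelow_pow_pos hc1
    rcases le_or_gt c u with hcu | hcu
    · rw [← h.valueOf_of_ge hc1, ← probBelow] at hc2
      have := mul_right_cancel₀ hR.ne' hc2
      have : c = b := h.injOn_valueOf ⟨hlμ.le.trans hc1, hcu⟩ hb (by linarith)
      rw [this, min_eq_left hb.2]
    -- A solution c > u would make the right side c - μ. But v - c ≤ `valueOf n l μ u u` - u and a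
    -- smaller second factor keep it at most u - μ.
    · exfalso
      rw [h.lossHigh_of_top_le hn hcu.le, ← probBelow] at hc2
      have hle := (h.strictMonoOn_valueOf.le_iff_le hb hu).2 hb.2
      have htop := h.valueOf_of_ge hμ.le
      rw [h.lossHigh_top] at htop
      have hRu := h.one_sub_probBelow_pow_pos hμ.le
      have hRlt := h.one_sub_probBelow_pow_lt hμ.le hcu
      have hvc : 0 < valueOf n l μ u b - c :=
        pos_of_mul_pos_left (hc2 ▸ (by linarith : 0 < c - μ)) hR.le
      have h1 := mul_le_mul_of_nonneg_left hRlt.le hvc.le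
      have h2 := mul_le_mul_of_nonneg_right
        (show valueOf n l μ u b - c ≤ valueOf n l μ u u - u by linarith) hRu.le
      linarith

lemma betaIND_valueOf (h : IsNondegenerate n l μ u) (hb : b ∈ Set.Icc l u) :
    betaIND n l μ u (valueOf n l μ u b) = b := by
  rw [betaIND]
  split_ifs with hn
  · subst hn
    exact h.betaTwo_valueOf hb
  · exact h.min_eq_of_bidEquation hn hb
      (Classical.epsilon_spec (p := BidEquation n l μ u (valueOf n l μ u b))
        ⟨b, h.bidEquation_valueOf hb⟩)

end IsNondegenerate

/-- The smallest monotone left inverse of `valueOf` on `[l, u]`. -/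
def bidOf (n : ℕ) (l μ u v : ℝ) : ℝ := sSup {b ∈ Set.Icc l u | valueOf n l μ u b ≤ v}

/-! ### The equilibrium strategy -/

namespace IsNondegenerate

variable {n : ℕ} {l μ u b v : ℝ}

lemma bidOf_valueOf (h : IsNondegenerate n l μ u) (hb : b ∈ Set.Icc l u) :
    bidOf n l μ u (valueOf n l μ u b) = b := by
  have : {c ∈ Set.Icc l u | valueOf n l μ u c ≤ valueOf n l μ u b} = Set.Icc l b := by
    ext c
    refine ⟨fun hc => ⟨hc.1.1, (h.strictMonoOn_valueOf.le_iff_le hc.1 hb).1 hc.2⟩, fun hc => ?_⟩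
    have hc' : c ∈ Set.Icc l u := ⟨hc.1, hc.2.trans hb.2⟩
    exact ⟨hc', (h.strictMonoOn_valueOf.le_iff_le hc' hb).2 hc.2⟩
  rw [bidOf, this, csSup_Icc hb.1]

/-- Monotonicity on all of ℝ supplies the measurability required of a strategy. -/
lemma monotone_bidOf (h : IsNondegenerate n l μ u) : Monotone (bidOf n l μ u) := by
  intro v w hvw
  rcases Set.eq_empty_or_nonempty {b ∈ Set.Icc l u | valueOf n l μ u b ≤ v} with he | hne
  -- The supremum of the empty set is 0, which is still low enough because l ≥ 0.
  · rw [bidOf, he, Real.sSup_empty]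
    exact Real.sSup_nonneg fun b hb => h.nonneg.trans hb.1.1
  · exact csSup_le_csSup ⟨u, fun b hb => hb.1.2⟩ hne fun b hb => ⟨hb.1, hb.2.trans hvw⟩

lemma strictMonoOn_bidOf (h : IsNondegenerate n l μ u) :
    StrictMonoOn (bidOf n l μ u) (Set.Icc l (valueOf n l μ u u)) := by
  intro v hv w hw hvw
  obtain ⟨b, hb, rfl⟩ := h.exists_valueOf_eq hv
  obtain ⟨c, hc, rfl⟩ := h.exists_valueOf_eq hw
  rw [h.bidOf_valueOf hb, h.bidOf_valueOf hc]
  exact (h.strictMonoOn_valueOf.lt_iff_lt hb hc).1 hvw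

lemma isMinimaxBid_bidOf (h : IsNondegenerate n l μ u) (i : Fin n)
    (hv : v ∈ Set.Icc l (valueOf n l μ u u)) :
    IsMinimaxBid i l μ u v (bidOf n l μ u v) := by
  obtain ⟨b, hb, rfl⟩ := h.exists_valueOf_eq hv
  rw [h.bidOf_valueOf hb]
  exact h.isMinimaxBid_valueOf i hb

end IsNondegenerate

/-! ### Supports of image measures and strict bounds on means -/

section Support

variable {P : Measure ℝ} {a b : ℝ}

lemma ae_mem_Icc_of_isLeast_of_isGreatest (ha : IsLeast P.support a)
    (hb : IsGreatest P.support b) : ∀ᵐ x ∂P, x ∈ Set.Icc a b := by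
  filter_upwards [Measure.support_mem_ae (μ := P)] with x hx using ⟨ha.2 hx, hb.2 hx⟩

lemma pos_of_mem_support {x : ℝ} (hx : x ∈ P.support) {U : Set ℝ} (hU : U ∈ nhds x) :
    0 < P U :=
  (Measure.mem_support_iff_forall x).1 hx U hU

/-- The support is compact, so its continuous image is closed and its complement is null. -/
lemma support_map_eq_image {f : ℝ → ℝ} (hf : Continuous f) (ha : IsLeast P.support a)
    (hb : IsGreatest P.support b) : (P.map f).support = f '' P.support := by
  have hcomp : IsCompact P.support :=
    isCompact_Icc.of_isClosed_subset Measure.isClosed_support fun x hx => ⟨ha.2 hx, hb.2 hx⟩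
  apply Set.Subset.antisymm
  · intro v hv
    by_contra hv'
    have hU : (f '' P.support)ᶜ ∈ nhds v := (hcomp.image hf).isClosed.isOpen_compl.mem_nhds hv'
    have h1 := pos_of_mem_support hv hU
    rw [Measure.map_apply hf.measurable (hcomp.image hf).isClosed.measurableSet.compl] at h1
    refine h1.ne' (measure_mono_null (t := P.supportᶜ) ?_ Measure.measure_compl_support)
    exact fun x hx hxs => hx ⟨x, hxs, rfl⟩
  · rintro _ ⟨x, hx, rfl⟩
    rw [Measure.mem_support_iff_forall]
    intro U hU
    exact (pos_of_mem_support hx (hf.continuousAt hU)).trans_le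
      (Measure.le_map_apply hf.measurable.aemeasurable U)

variable {f : ℝ → ℝ} [IsProbabilityMeasure P]

lemma integrable_of_monotoneOn_Icc (hf : Measurable f) (hmono : MonotoneOn f (Set.Icc a b))
    (hP : ∀ᵐ x ∂P, x ∈ Set.Icc a b) : Integrable f P := by
  refine Integrable.of_bound hf.aestronglyMeasurable (max |f a| |f b|) ?_
  filter_upwards [hP] with x hx
  have hab := hx.1.trans hx.2
  exact abs_le_max_abs_abs (hmono ⟨le_rfl, hab⟩ hx hx.1) (hmono hx ⟨hab, le_rfl⟩ hx.2)

lemma lt_integral_of_strictMonoOn (hf : Measurable f) (hmono : StrictMonoOn f (Set.Icc a b))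
    (hP : ∀ᵐ x ∂P, x ∈ Set.Icc a b) (hpos : 0 < P (Set.Ioi a)) : f a < ∫ x, f x ∂P := by
  have hi := integrable_of_monotoneOn_Icc hf hmono.monotoneOn hP
  have h0 : 0 < ∫ x, (f x - f a) ∂P := by
    refine (integral_pos_iff_support_of_nonneg_ae ?_ (hi.sub (integrable_const _))).2 ?_
    swap
    · refine hpos.trans_le (measure_mono_ae ?_)
      filter_upwards [hP] with x hx hax
      exact (sub_pos.2 (hmono ⟨le_rfl, hx.1.trans hx.2⟩ hx hax)).ne'
    · filter_upwards [hP] with x hx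
      exact sub_nonneg.2 (hmono.monotoneOn ⟨le_rfl, hx.1.trans hx.2⟩ hx hx.1)
  rw [integral_sub hi (integrable_const _)] at h0
  simpa using h0

lemma integral_lt_of_strictMonoOn (hf : Measurable f) (hmono : StrictMonoOn f (Set.Icc a b))
    (hP : ∀ᵐ x ∂P, x ∈ Set.Icc a b) (hpos : 0 < P (Set.Iio b)) : ∫ x, f x ∂P < f b := by
  have hi := integrable_of_monotoneOn_Icc hf hmono.monotoneOn hP
  have h0 : 0 < ∫ x, (f b - f x) ∂P := by
    refine (integral_pos_iff_support_of_nonneg_ae ?_ ((integrable_const _).sub hi)).2 ?_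
    swap
    · refine hpos.trans_le (measure_mono_ae ?_)
      filter_upwards [hP] with x hx hax
      exact (sub_pos.2 (hmono hx ⟨hx.1.trans hx.2, le_rfl⟩ hax)).ne'
    · filter_upwards [hP] with x hx
      exact sub_nonneg.2 (hmono.monotoneOn hx ⟨hx.1.trans hx.2, le_rfl⟩ hx.2)
  rw [integral_sub (integrable_const _) hi] at h0
  simpa using h0

end Support

/-! ### Existence: pushing G forward along `valueOf` -/

section Existence

variable {n : ℕ} {l μ u : ℝ} {G : Measure ℝ} [IsProbabilityMeasure G]

lemma IsNondegenerate.isValueDistribution (h : IsNondegenerate n l μ u)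
    (hl : IsLeast G.support l) (hu : IsGreatest G.support u) :
    IsValueDistribution (G.map (valueOf n l μ u)) l (valueOf n l μ u u) := by
  have hs := support_map_eq_image h.continuous_valueOf hl hu
  have hmem : ∀ b ∈ G.support, b ∈ Set.Icc l u := fun b hb => ⟨hl.2 hb, hu.2 hb⟩
  have hmono := h.strictMonoOn_valueOf.monotoneOn
  refine ⟨Measure.isProbabilityMeasure_map h.continuous_valueOf.measurable.aemeasurable,
    ?_, ?_, h.nonneg, h.lt_top.trans (h.lt_valueOf h.lt_top le_rfl)⟩
  · rw [hs]
    refine ⟨⟨l, hl.1, h.valueOf_bot⟩, ?_⟩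
    rintro _ ⟨b, hb, rfl⟩
    exact (hl.2 hb).trans (h.le_valueOf (hmem b hb))
  · rw [hs]
    refine ⟨⟨u, hu.1, rfl⟩, ?_⟩
    rintro _ ⟨b, hb, rfl⟩
    exact hmono (hmem b hb) (hmem u hu.1) (hu.2 hb)

lemma IsNondegenerate.rationalizes (h : IsNondegenerate n l μ u)
    (hl : IsLeast G.support l) (hu : IsGreatest G.support u) (hμ : ∫ b, b ∂G = μ) :
    Rationalizes n (G.map (valueOf n l μ u)) G := by
  have hν := h.continuous_valueOf.measurable
  have hβ := h.monotone_bidOf.measurable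
  have hs := support_map_eq_image h.continuous_valueOf hl hu
  have hae := ae_mem_Icc_of_isLeast_of_isGreatest hl hu
  have hF := h.isValueDistribution hl hu
  have himage : bidOf n l μ u '' (G.map (valueOf n l μ u)).support = G.support := by
    rw [hs, Set.image_image, Set.image_congr (g := id), Set.image_id]
    exact fun b hb => h.bidOf_valueOf ⟨hl.2 hb, hu.2 hb⟩
  refine ⟨l, valueOf n l μ u u, hF, fun _ => bidOf n l μ u, fun _ => l, fun _ => μ, fun _ => u,
    ⟨fun _ => hβ, fun i v hv => h.isMinimaxBid_bidOf i ⟨hF.least.2 hv, hF.greatest.2 hv⟩,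
      fun i j _ => ?_, fun i j _ => ?_, fun i j _ => ?_⟩,
    fun i => ⟨fun v hv => h.isMinimaxBid_bidOf i hv, h.strictMonoOn_bidOf⟩, fun i => ?_⟩
  · rw [integral_map hν.aemeasurable hβ.aestronglyMeasurable, ← hμ]
    refine integral_congr_ae ?_
    filter_upwards [hae] with b hb
    rw [hμ, h.bidOf_valueOf hb]
  · rw [himage]
    exact hl.isGLB
  · rw [himage]
    exact hu.isLUB
  · rw [Measure.map_map hβ hν, Measure.map_congr (g := id), Measure.map_id]
    filter_upwards [hae] with b hb using h.bidOf_valueOf hb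

lemma IsNondegenerate.cdf_map_valueOf (h : IsNondegenerate n l μ u)
    (hl : IsLeast G.support l) (hu : IsGreatest G.support u) {v : ℝ}
    (hv : v ∈ Set.Icc l (valueOf n l μ u u)) :
    cdf (G.map (valueOf n l μ u)) v = cdf G (betaIND n l μ u v) := by
  have hν := h.continuous_valueOf.measurable
  have := (h.isValueDistribution hl hu).prob
  obtain ⟨b, hb, rfl⟩ := h.exists_valueOf_eq hv
  rw [h.betaIND_valueOf hb, cdf_eq_real, cdf_eq_real, map_measureReal_apply hν measurableSet_Iic]
  refine measureReal_congr ?_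
  filter_upwards [ae_mem_Icc_of_isLeast_of_isGreatest hl hu] with c hc
  exact propext (h.strictMonoOn_valueOf.le_iff_le hc hb)

lemma IsNondegenerate.support_map_valueOf (h : IsNondegenerate n l μ u)
    (hl : IsLeast G.support l) (hu : IsGreatest G.support u) (hG : G.support = Set.Icc l u) :
    (G.map (valueOf n l μ u)).support = Set.Icc l (valueOf n l μ u u) := by
  have hF := h.isValueDistribution hl hu
  refine Set.Subset.antisymm (fun v hv => ⟨hF.least.2 hv, hF.greatest.2 hv⟩) fun v hv => ?_
  obtain ⟨b, hb, rfl⟩ := h.exists_valueOf_eq hv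
  rw [support_map_eq_image h.continuous_valueOf hl hu, hG]
  exact ⟨b, hb, rfl⟩

end Existence

/-! ### Uniqueness: every separating equilibrium comes from `valueOf` -/

section Uniqueness

variable {n : ℕ} {l μ u vlo vhi : ℝ} {i : Fin n}

/-- With a value above `l`, a minimax bid is above `l` and below the value. -/
lemma IsNondegenerate.lt_of_isMinimaxBid {v b : ℝ} (h : IsNondegenerate n l μ u) (hv : l < v)
    (hb : IsMinimaxBid i l μ u v b) : l < b ∧ b < v := by
  rcases le_or_gt v (valueOf n l μ u u) with hvu | hvu
  · obtain ⟨c, hc, rfl⟩ := h.exists_valueOf_eq ⟨hv.le, hvu⟩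
    have hlc : l < c := by
      refine lt_of_le_of_ne hc.1 fun hlc => hv.ne ?_
      rw [← hlc, h.valueOf_bot]
    rw [h.eq_of_isMinimaxBid_valueOf hc (Or.inl hlc) hb]
    exact ⟨hlc, h.lt_valueOf hlc hc.2⟩
  · rw [h.eq_top_of_isMinimaxBid hvu hb]
    exact ⟨h.lt_top, (h.lt_valueOf h.lt_top le_rfl).trans hvu⟩

/-- Strict monotonicity keeps all values within the range of `valueOf`: two values above it would
both bid u. `hlβ` avoids the exceptional bids below l, so uniqueness of minimax bids applies. -/
lemma IsNondegenerate.valueOf_eq_of_strictMonoOn {β : ℝ → ℝ} (h : IsNondegenerate n l μ u)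
    (hlt : vlo < vhi) (hl : l ≤ vlo) (hβ : StrictMonoOn β (Set.Icc vlo vhi))
    (hopt : ∀ v ∈ Set.Icc vlo vhi, IsMinimaxBid i l μ u v (β v)) (hlβ : l ≤ β vlo) {v : ℝ}
    (hv : v ∈ Set.Icc vlo vhi) : β v ∈ Set.Icc l u ∧ valueOf n l μ u (β v) = v := by
  have hhi : vhi ∈ Set.Icc vlo vhi := ⟨hlt.le, le_rfl⟩
  have hle : vhi ≤ valueOf n l μ u u := by
    by_contra! hgt
    obtain ⟨w, hw1, hw2⟩ := exists_between (max_lt hlt hgt)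
    have hw : w ∈ Set.Icc vlo vhi := ⟨(le_max_left _ _).trans hw1.le, hw2.le⟩
    have h1 := h.eq_top_of_isMinimaxBid ((le_max_right _ _).trans_lt hw1) (hopt w hw)
    have h2 := h.eq_top_of_isMinimaxBid hgt (hopt vhi hhi)
    exact (hβ hw hhi hw2).ne (h1.trans h2.symm)
  obtain ⟨b, hb, rfl⟩ := h.exists_valueOf_eq ⟨hl.trans hv.1, hv.2.trans hle⟩
  have hmono := hβ.monotoneOn ⟨le_rfl, hlt.le⟩ hv hv.1
  rw [h.eq_of_isMinimaxBid_valueOf hb (Or.inr (hlβ.trans hmono)) (hopt _ hv)]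
  exact ⟨hb, rfl⟩

/-- The lowest point of the support of the law of a bidding function inverse to `valueOf`. -/
lemma eq_of_isLeast_support {F G : Measure ℝ} [IsProbabilityMeasure F] {β : ℝ → ℝ} {l' u' : ℝ}
    (h : IsNondegenerate n l' μ u') (hF : ∀ᵐ v ∂F, v ∈ Set.Icc vlo vhi) (hlt : vlo ≤ vhi)
    (hvlo : vlo ∈ F.support) (hβm : Measurable β) (hβ : StrictMonoOn β (Set.Icc vlo vhi))
    (hinv : ∀ v ∈ Set.Icc vlo vhi, β v ∈ Set.Icc l' u' ∧ valueOf n l' μ u' (β v) = v)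
    (hG : F.map β = G) (hl : IsLeast G.support l) : β vlo = l := by
  have hlo : vlo ∈ Set.Icc vlo vhi := ⟨le_rfl, hlt⟩
  apply le_antisymm
  · by_contra! hlt
    have h1 := pos_of_mem_support hl.1 (Iio_mem_nhds hlt)
    rw [← hG, Measure.map_apply hβm measurableSet_Iio] at h1
    refine h1.ne' (measure_eq_zero_iff_ae_notMem.2 ?_)
    filter_upwards [hF] with v hv
    exact not_lt.2 (hβ.monotoneOn hlo hv hv.1)
  · by_contra! hlt
    -- No continuity of β is assumed, so the gap between β vlo and l is carried through `valueOf` to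
    -- a neighbourhood of vlo without mass.
    have hae : ∀ᵐ v ∂F, l ≤ β v := by
      have : ∀ᵐ b ∂(F.map β), l ≤ b := by
        rw [hG]
        filter_upwards [Measure.support_mem_ae (μ := G)] with b hb using hl.2 hb
      exact ae_of_ae_map hβm.aemeasurable this
    have hlmem : l ∈ Set.Icc l' u' := by
      obtain ⟨v, hv1, hv2⟩ := (hF.and hae).exists
      exact ⟨(hinv vlo hlo).1.1.trans hlt.le, hv2.trans (hinv v hv1).1.2⟩
    have hlt' : vlo < valueOf n l' μ u' l := by
      have := h.strictMonoOn_valueOf (hinv vlo hlo).1 hlmem hlt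
      rwa [(hinv vlo hlo).2] at this
    refine (pos_of_mem_support hvlo (Iio_mem_nhds hlt')).ne' (measure_eq_zero_iff_ae_notMem.2 ?_)
    filter_upwards [hF, hae] with v hv hlv
    have := h.strictMonoOn_valueOf.monotoneOn hlmem (hinv v hv).1 hlv
    rw [(hinv v hv).2] at this
    exact not_lt.2 this

/-- The highest point of the support of the law of a bidding function inverse to `valueOf`. -/
lemma eq_of_isGreatest_support {F G : Measure ℝ} [IsProbabilityMeasure F] {β : ℝ → ℝ}
    {l' u' : ℝ} (h : IsNondegenerate n l' μ u') (hF : ∀ᵐ v ∂F, v ∈ Set.Icc vlo vhi)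
    (hlt : vlo ≤ vhi) (hvhi : vhi ∈ F.support) (hβm : Measurable β)
    (hβ : StrictMonoOn β (Set.Icc vlo vhi))
    (hinv : ∀ v ∈ Set.Icc vlo vhi, β v ∈ Set.Icc l' u' ∧ valueOf n l' μ u' (β v) = v)
    (hG : F.map β = G) (hu : IsGreatest G.support u) : β vhi = u := by
  have hhi : vhi ∈ Set.Icc vlo vhi := ⟨hlt, le_rfl⟩
  apply le_antisymm
  · by_contra! hlt
    have hae : ∀ᵐ v ∂F, β v ≤ u := by
      have : ∀ᵐ b ∂(F.map β), b ≤ u := by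
        rw [hG]
        filter_upwards [Measure.support_mem_ae (μ := G)] with b hb using hu.2 hb
      exact ae_of_ae_map hβm.aemeasurable this
    have humem : u ∈ Set.Icc l' u' := by
      obtain ⟨v, hv1, hv2⟩ := (hF.and hae).exists
      exact ⟨(hinv v hv1).1.1.trans hv2, hlt.le.trans (hinv vhi hhi).1.2⟩
    have hlt' : valueOf n l' μ u' u < vhi := by
      have := h.strictMonoOn_valueOf humem (hinv vhi hhi).1 hlt
      rwa [(hinv vhi hhi).2] at this
    refine (pos_of_mem_support hvhi (Ioi_mem_nhds hlt')).ne' (measure_eq_zero_iff_ae_notMem.2 ?_)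
    filter_upwards [hF, hae] with v hv huv
    have := h.strictMonoOn_valueOf.monotoneOn (hinv v hv).1 humem huv
    rw [(hinv v hv).2] at this
    exact not_lt.2 this
  · by_contra! hlt
    have h1 := pos_of_mem_support hu.1 (Ioi_mem_nhds hlt)
    rw [← hG, Measure.map_apply hβm measurableSet_Ioi] at h1
    refine h1.ne' (measure_eq_zero_iff_ae_notMem.2 ?_)
    filter_upwards [hF] with v hv
    exact not_lt.2 (hβ.monotoneOn hv hhi hv.2)

lemma exists_ne_of_two_le (hn : 2 ≤ n) (i : Fin n) : ∃ j, j ≠ i := by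
  have : Nontrivial (Fin n) := Fin.nontrivial_iff_two_le.2 hn
  exact exists_ne i

/-- If every bidder's lowest bid is the others' lower belief, no such belief exceeds the lowest
value, and all bids at the lowest value are at least the lower belief. -/
lemma lower_le_of_separating {β : Fin n → ℝ → ℝ} {l' u' : Fin n → ℝ} (hn : 2 ≤ n)
    (h : ∀ i, IsNondegenerate n (l' i) μ (u' i)) (hvlo : 0 ≤ vlo) (hlt : vlo < vhi)
    (hlow : ∀ i j, j ≠ i → l' j = β i vlo)
    (hopt : ∀ i, ∀ v ∈ Set.Icc vlo vhi, IsMinimaxBid i (l' i) μ (u' i) v (β i v))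
    (hβ : ∀ i, StrictMonoOn (β i) (Set.Icc vlo vhi)) (i : Fin n) :
    l' i ≤ vlo ∧ l' i ≤ β i vlo := by
  have hlo : vlo ∈ Set.Icc vlo vhi := ⟨le_rfl, hlt.le⟩
  obtain ⟨j, hj⟩ := exists_ne_of_two_le hn i
  have hi := hlow j i hj.symm
  have hj' := hlow i j hj
  have hle : l' i ≤ vlo := by
    by_contra! hgt
    have h1 : vlo ≤ l' j := by
      by_contra! hlt'
      have := ((h j).lt_of_isMinimaxBid hlt' (hopt j vlo hlo)).2
      linarith
    have h2 := (h j).le_of_isMinimaxBid hvlo h1 (hopt j vlo hlo)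
    obtain ⟨v, hv1, hv2⟩ := exists_between (lt_min hgt hlt)
    have hv : v ∈ Set.Icc vlo vhi := ⟨hv1.le, hv2.le.trans (min_le_right _ _)⟩
    have h3 := (h i).le_of_isMinimaxBid (hvlo.trans hv1.le) (hv2.le.trans (min_le_left _ _))
      (hopt i v hv)
    have h4 := hβ i hlo hv hv1
    -- The contradiction is the cycle l' i = β j vlo ≤ l' j = β i vlo < β i v ≤ l' i.
    linarith
  refine ⟨hle, ?_⟩
  rcases hle.lt_or_eq with hlt' | heq
  · exact ((h i).lt_of_isMinimaxBid hlt' (hopt i vlo hlo)).1.le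
  · by_contra! hgt
    have := ((h j).lt_of_isMinimaxBid (v := vlo) (by linarith) (hopt j vlo hlo)).2
    linarith

lemma Rationalizes.eq_map_valueOf {F G : Measure ℝ} (h : Rationalizes n F G) (hn : 2 ≤ n)
    (hl : IsLeast G.support l) (hu : IsGreatest G.support u) (hμ : ∫ b, b ∂G = μ) :
    IsNondegenerate n l μ u ∧ F = G.map (valueOf n l μ u) := by
  obtain ⟨vlo, vhi, hF, β, l', μ', u', hE, hS, hmap⟩ := h
  have := hF.prob
  have hlt := hF.lt
  have hlo : vlo ∈ Set.Icc vlo vhi := ⟨le_rfl, hlt.le⟩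
  have hhi : vhi ∈ Set.Icc vlo vhi := ⟨hlt.le, le_rfl⟩
  have hae := ae_mem_Icc_of_isLeast_of_isGreatest hF.least hF.greatest
  have hsub : ∀ v ∈ F.support, v ∈ Set.Icc vlo vhi :=
    fun v hv => ⟨hF.least.2 hv, hF.greatest.2 hv⟩
  have hlow : ∀ i j, j ≠ i → l' j = β i vlo := fun i j hij => by
    refine (hE.lower_consistent i j hij).unique (IsLeast.isGLB ⟨⟨vlo, hF.least.1, rfl⟩, ?_⟩)
    rintro _ ⟨v, hv, rfl⟩
    exact (hS i).2.monotoneOn hlo (hsub v hv) (hF.least.2 hv)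
  have hupp : ∀ i j, j ≠ i → u' j = β i vhi := fun i j hij => by
    refine (hE.upper_consistent i j hij).unique (IsGreatest.isLUB ⟨⟨vhi, hF.greatest.1, rfl⟩, ?_⟩)
    rintro _ ⟨v, hv, rfl⟩
    exact (hS i).2.monotoneOn (hsub v hv) hhi (hF.greatest.2 hv)
  have hmean : ∀ i, ∫ v, β i v ∂F = μ := fun i => by
    rw [← hμ, ← hmap i]
    exact (integral_map (f := fun b => b) (hE.measurable i).aemeasurable
      measurable_id.aestronglyMeasurable).symm
  have hμ' : ∀ j, μ' j = μ := fun j => by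
    obtain ⟨i, hi⟩ := exists_ne_of_two_le hn j
    rw [← hE.mean_consistent i j hi.symm, hmean]
  -- Beliefs may still differ across bidders here; each bidder's beliefs are read off from the bids
  -- of some other bidder.
  have hnd : ∀ j, IsNondegenerate n (l' j) μ (u' j) := fun j => by
    obtain ⟨i, hi⟩ := exists_ne_of_two_le hn j
    rw [hlow i j hi.symm, hupp i j hi.symm, ← hmean i]
    exact ⟨hn, ((hS i).1 vlo hlo).1,
      lt_integral_of_strictMonoOn (hE.measurable i) (hS i).2 hae
        (pos_of_mem_support hF.greatest.1 (Ioi_mem_nhds hlt)),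
      integral_lt_of_strictMonoOn (hE.measurable i) (hS i).2 hae
        (pos_of_mem_support hF.least.1 (Iio_mem_nhds hlt))⟩
  have hopt : ∀ i, ∀ v ∈ Set.Icc vlo vhi, IsMinimaxBid i (l' i) μ (u' i) v (β i v) :=
    fun i => hμ' i ▸ (hS i).1
  have hlower := lower_le_of_separating hn hnd hF.nonneg hlt hlow hopt fun i => (hS i).2
  have hinv : ∀ i, ∀ v ∈ Set.Icc vlo vhi,
      β i v ∈ Set.Icc (l' i) (u' i) ∧ valueOf n (l' i) μ (u' i) (β i v) = v := fun i v hv =>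
    (hnd i).valueOf_eq_of_strictMonoOn hlt (hlower i).1 (hS i).2 (hopt i) (hlower i).2 hv
  let i : Fin n := ⟨0, by omega⟩
  obtain ⟨j, hj⟩ := exists_ne_of_two_le hn i
  -- Only now does the common bid law G pin down the belief bounds: bidder j's extreme bids are the
  -- endpoints of its support.
  have hli : l' i = l := (hlow j i hj.symm).trans (eq_of_isLeast_support (hnd j) hae hlt.le
    hF.least.1 (hE.measurable j) (hS j).2 (hinv j) (hmap j) hl)
  have hui : u' i = u := (hupp j i hj.symm).trans (eq_of_isGreatest_support (hnd j) hae hlt.le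
    hF.greatest.1 (hE.measurable j) (hS j).2 (hinv j) (hmap j) hu)
  have hndi := hnd i
  have hinvi := hinv i
  rw [hli, hui] at hndi hinvi
  refine ⟨hndi, ?_⟩
  rw [← hmap i, Measure.map_map hndi.continuous_valueOf.measurable (hE.measurable i),
    Measure.map_congr (g := id), Measure.map_id]
  filter_upwards [hae] with v hv using (hinvi v hv).2

end Uniqueness

end MomentEq

end

theorem theorem4 (n : ℕ) (hn : 2 ≤ n) (G : MeasureTheory.Measure ℝ)
    [MeasureTheory.IsProbabilityMeasure G] (l μ u : ℝ) (hl0 : 0 ≤ l)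
    (hl : IsLeast G.support l) (hu : IsGreatest G.support u) (hμ : ∫ b, b ∂G = μ) :
    ((∃ F : MeasureTheory.Measure ℝ, MomentEq.Rationalizes n F G) ↔ l < μ ∧ μ < u) ∧
    ∀ F : MeasureTheory.Measure ℝ, MomentEq.Rationalizes n F G →
      (∀ F' : MeasureTheory.Measure ℝ, MomentEq.Rationalizes n F' G → F' = F) ∧
      ∃ vlo vhi : ℝ, MomentEq.IsValueDistribution F vlo vhi ∧
        (G.support = Set.Icc l u → F.support = Set.Icc vlo vhi) ∧
        ∀ v ∈ Set.Icc vlo vhi,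
          ProbabilityTheory.cdf F v =
            ProbabilityTheory.cdf G (MomentEq.betaIND n l μ u v) := by
  refine ⟨⟨?_, fun h => ?_⟩, fun F hF => ⟨fun F' hF' => ?_, ?_⟩⟩
  · rintro ⟨F, hF⟩
    have h := (hF.eq_map_valueOf hn hl hu hμ).1
    exact ⟨h.lt_mean, h.mean_lt⟩
  · exact ⟨_, MomentEq.IsNondegenerate.rationalizes ⟨hn, hl0, h.1, h.2⟩ hl hu hμ⟩
  · rw [(hF.eq_map_valueOf hn hl hu hμ).2, (hF'.eq_map_valueOf hn hl hu hμ).2]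
  · obtain ⟨h, rfl⟩ := hF.eq_map_valueOf hn hl hu hμ
    exact ⟨l, MomentEq.valueOf n l μ u u, h.isValueDistribution hl hu,
      h.support_map_valueOf hl hu, fun v hv => h.cdf_map_valueOf hl hu hv⟩
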